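/- **Setting.** Let $n\ge 1$, $m\ge 0$, and consider the triangular system $$\dot x_i=a_{i+1}(t,x_1,u)\,x_{i+1}+f_i(t,x_1,u),\quad i=1,\dots,n-1,\qquad \dot x_n=f_n(t,x_1,\dots,x_n,u),\qquad y=x_1, \tag{3.1}$$ $t\ge 0$, $x\in\mathbb R^n$, $u\in\mathbb R^m$. Write it as $\dot x=A(t,y,u)x+f(t,y,x,u)$, $y=Cx$, where $A(t,y,u)$ has the entries $a_2,\dots,a_n$ on the superdiagonal and zeros elsewhere, $C=[1\,0\cdots 0]$, and $f=(f_1(t,y,u),\dots,f_{n-1}(t,y,u),f_n(t,y,x_2,\dots,x_n,u))'$. For $t_0\ge0$ and $\tau>t_0$ the inputs are $U_{[t_0,\tau]}=L_\infty([t_0,\tau];\mathbb R^m)$ (functions with a value at each point). Solutions are absolutely continuous, satisfying the equation almost everywhere. We say that $x_0$ and $u$ produce $y$ on $[t_0,\tau]$ if there is a solution $x$ on $[t_0,\tau]$ with input $u$, $x(t_0)=x_0$ and $y=Cx$ a.e. on $[t_0,\tau]$. $Y_{[t_0,\tau],u}$ is the set of $y\in L_\infty([t_0,\tau];\mathbb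 R)$ produced by some $x_0$ and $u$. $\|\cdot\|_S$ is the essential supremum over $S$ of the Euclidean norm. **H1.** For fixed values of the other arguments, $a_i$, $f_i$ $(i<n)$ and $f_n$ are measurable and locally essentially bounded in $t\ge0$; for the $a_i$ the local essential bound is uniform for $(y,u)$ in bounded sets. For fixed $t\ge0$ they are continuous in the remaining arguments jointly, and for fixed $t\ge 0$ and $u$ they are locally Lipschitz in the state arguments. Moreover, $f_n$ is Lipschitz in $(x_2,\dots,x_n)$ with one constant on each bounded set of $(t,x,u)$. **H2.** $I\subset\mathbb R_{\ge0}$ is measurable with nonempty interior, and for each $t_0\in I$, all $\tau>t_0$ close to $t_0$, all $u\in U_{[t_0,\tau]}$ and all continuous $y\in Y_{[t_0,\tau],u}$ we have $\prod_{i=2}^n a_i(t_0,y(t_0),u(t_0))\neq0$. In addition, $I\cap(t-\varepsilon,t+\varepsilon)$ has positive measure for all $t\in I$ and $\varepsilon>0$. **Notation.** $\Phi(\cdot,t_0)$ is the solution of $\partial_t\Phi(t,t_0)=A(t,y(t),u(t))\Phi(t,t_0)$ a.e., $\Phi(t_0,t_0)=\mathrm{Id}$, with $\Phi(t,\rho)=\Phi(t,t_0)\Phi(\rho,t_0)^{-1}$,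 and $$\Psi(t)=\int_{t_0}^t\Phi'(s,t_0)C'C\Phi(s,t_0)\,ds,\qquad \Xi(t;d)=\int_{t_0}^t\Phi'(\rho,t_0)C'C\Phi(\rho,t_0)\int_{t_0}^\rho\Phi(t_0,s)f(s,y(s),d(s),u(s))\,ds\,d\rho,$$ $$\mathcal F_T(t;z)=\Phi(t,t_0)\Psi^{-1}(T)\Big(\int_{t_0}^T\Phi'(\rho,t_0)C'y(\rho)\,d\rho-\Xi(T;z)\Big)+\int_{t_0}^t\Phi(t,\rho)f(\rho,y(\rho),z(\rho),u(\rho))\,d\rho .$$ **Proposition 3.1.** Under H1 and H2 there is a set $\hat I\subset I$ with $\operatorname{cl}\hat I=\operatorname{cl}I$ (so $\operatorname{cl}\hat I=I$ when $I$ is closed) such that the following hold. * **A1 over $\hat I$.** $\hat I$ is nonempty, and for all $t_0\in\hat I$, all $\tau>t_0$ close to $t_0$, all $u\in U_{[t_0,\tau]}$ and $y\in Y_{[t_0,\tau],u}$: the matrix $\Phi(\cdot,t_0)$ exists on $[t_0,\tau]$ and $\Psi(t)$ is positive definite for all $t\in(t_0,\tau]$. * **A2 over $\hat I$.** For all $t_0\in\hat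 I$, all $T>t_0$ close to $t_0$, all $u\in U_{[t_0,T]}$, $y\in Y_{[t_0,T],u}$, $\ell\in(0,1)$ and $R,\theta>0$ there is $\tau\in(t_0,\min\{t_0+\theta,T\})$ with $$\big\|\Psi^{-1}(\cdot)\,[\Xi(\cdot;d_1)-\Xi(\cdot;d_2)]\big\|_{(t_0,\tau]}\le\ell\,\|d_1-d_2\|_{[t_0,\tau]}$$ for all continuous $d_1,d_2:[t_0,\tau]\to\mathbb R^n$ with $\|d_1\|_{[t_0,\tau]},\|d_2\|_{[t_0,\tau]}\le R$. * **The approximate state estimation problem is solvable over $\hat I$, by iteration of $\mathcal F$.** There are functionals $X_\nu(t_0,\tau,y,u)\in\mathbb R^n$, $\nu=0,1,2,\dots$, depending only on $t_0$, $\tau$ and the classes of $y,u$ in $L_\infty$ on $[t_0,\tau]$, such that for all $t_0\in\hat I$, all $\tau>t_0$ close to $t_0$, all $u\in U_{[t_0,\tau]}$ and $y\in Y_{[t_0,\tau],u}$, the limit $x_0=\lim_{\nu\to\infty}X_\nu(t_0,\tau,y,u)$ exists and is the unique initial state which, with $u$, produces $y$ on $[t_0,\tau]$. They are computed without differentiation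 of $y$ or $u$: for each such $(t_0,\tau,y,u)$ there are, for $i=0,1,2,\dots$, strictly decreasing sequences of times $t^i_\nu\in(t_0,\tau]$, $\nu=0,1,2,\dots$, with $\lim_\nu t^i_\nu=t_0$ for each $i$ and $\lim_\nu t^\nu_\nu=t_0$, such that $$\|\mathcal F_{t^i_\nu}(\cdot;d_1)-\mathcal F_{t^i_\nu}(\cdot;d_2)\|_{[t_0,t^i_\nu]}\le\tfrac12\|d_1-d_2\|_{[t_0,t^i_\nu]}$$ for all continuous $d_1,d_2:[t_0,t^i_\nu]\to\mathbb R^n$ of norm at most $(i+1)2^\nu$, and such that $X_\nu(t_0,\tau,y,u)=z^\nu_\nu(t^\nu_\nu)$, where $z^i_0=0$ and $z^i_{\nu+1}=\mathcal F_{t^i_\nu}(\cdot;z^i_\nu)$ on $[t_0,t^i_\nu]$. * **Observability over $\hat I$.** For all $t_0\in\hat I$, almost all $\tau>t_0$ near $t_0$, all $u\in U_{[t_0,\tau]}$ and $y\in Y_{[t_0,\tau],u}$ there is a unique $x_0\in\mathbb R^n$ which, with $u$, produces $y$ on $[t_0,\tau]$. -/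

import Mathlib

open MeasureTheory Set Filter Topology
open scoped ENNReal Matrix

noncomputable section

/-- `ℝⁿ` with its Euclidean norm. -/
abbrev Vec (n : ℕ) : Type := EuclideanSpace ℝ (Fin n)

/-- The action of a real matrix on Euclidean vectors. -/
def Matrix.act {p q : ℕ} (M : Matrix (Fin p) (Fin q) ℝ) (v : Vec q) : Vec p :=
  Matrix.toEuclideanLin M v

/-- `‖g‖_S`, the essential supremum of `|g|` over `S`. -/
def essNorm {n : ℕ} (S : Set ℝ) (g : ℝ → Vec n) : ℝ≥0∞ :=
  eLpNorm g (⊤ : ℝ≥0∞) (volume.restrict S)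

/-- The data of a system `ẋ = A(t,y,u) x + f(t,y,x,u)` with output `y = C(t,u) x`,
with `x ∈ ℝⁿ`, `y ∈ ℝᵏ`, `u ∈ ℝᵐ`. -/
structure ControlSystem (n k m : ℕ) where
  A : ℝ → Vec k → Vec m → Matrix (Fin n) (Fin n) ℝ
  f : ℝ → Vec k → Vec n → Vec m → Vec n
  C : ℝ → Vec m → Matrix (Fin k) (Fin n) ℝ

/-- A family of input sets `U_{[t₀,τ]}`; inputs are functions defined pointwise, of which only the
restriction to `[t₀,τ]` matters. -/
abbrev InputFamily (m : ℕ) : Type := ℝ → ℝ → Set (ℝ → Vec m)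

/-- `U_{[t₀,τ]} = L_∞([t₀,τ]; ℝᵐ)`. -/
def allInputs (m : ℕ) : InputFamily m :=
  fun t₀ τ => {u | MemLp u (⊤ : ℝ≥0∞) (volume.restrict (Icc t₀ τ))}

namespace ControlSystem

variable {n k m : ℕ} (S : ControlSystem n k m)

/-- The right-hand side of the closed equation, in which `y = C(t,u) x`. -/
def rhs (t : ℝ) (x : Vec n) (u : Vec m) : Vec n :=
  (S.A t ((S.C t u).act x) u).act x + S.f t ((S.C t u).act x) x u

/-- `x` is a (Carathéodory) solution on `[t₀,τ]` with input `u` and `x(t₀) = x₀`. -/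
structure IsSolution (t₀ τ : ℝ) (u : ℝ → Vec m) (x₀ : Vec n) (x : ℝ → Vec n) : Prop where
  continuousOn : ContinuousOn x (Icc t₀ τ)
  integrable : IntervalIntegrable (fun s => S.rhs s (x s) (u s)) volume t₀ τ
  eq : ∀ t ∈ Icc t₀ τ, x t = x₀ + ∫ s in t₀..t, S.rhs s (x s) (u s)

/-- The initial state `x₀` and the input `u` produce the output `y` on `[t₀,τ]`:
`y(t) = C(t,u(t)) x(t;t₀,x₀,u)` for almost all `t ∈ [t₀,τ]`. -/
def Produces (t₀ τ : ℝ) (u : ℝ → Vec m) (x₀ : Vec n) (y : ℝ → Vec k) : Prop :=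
  ∃ x : ℝ → Vec n, S.IsSolution t₀ τ u x₀ x ∧
    ∀ᵐ t ∂(volume.restrict (Icc t₀ τ)), y t = (S.C t (u t)).act (x t)

/-- The set `Y_{[t₀,τ],u}` of outputs on `[t₀,τ]` corresponding to `u`. -/
def outputs (t₀ τ : ℝ) (u : ℝ → Vec m) : Set (ℝ → Vec k) :=
  {y | MemLp y (⊤ : ℝ≥0∞) (volume.restrict (Icc t₀ τ)) ∧ ∃ x₀, S.Produces t₀ τ u x₀ y}

/-- Observability over `I`. -/
def Observable (U : InputFamily m) (I : Set ℝ) : Prop :=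
  ∀ t₀ ∈ I, ∃ δ > 0, ∀ᵐ τ ∂(volume.restrict (Ioo t₀ (t₀ + δ))),
    ∀ u ∈ U t₀ τ, ∀ y ∈ S.outputs t₀ τ u, ∃! x₀, S.Produces t₀ τ u x₀ y

/-- `Φ(t) = Φ(t,t₀)` is the fundamental matrix on `[t₀,τ]`:
`Φ' = A(t,y(t),u(t)) Φ` for almost all `t`, `Φ(t₀) = 1`, in integrated form. -/
structure IsFundamental (t₀ τ : ℝ) (y : ℝ → Vec k) (u : ℝ → Vec m)
    (Φ : ℝ → Matrix (Fin n) (Fin n) ℝ) : Prop where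
  continuousOn : ContinuousOn Φ (Icc t₀ τ)
  integrable : ∀ i j,
    IntervalIntegrable (fun s => (S.A s (y s) (u s) * Φ s) i j) volume t₀ τ
  eq : ∀ t ∈ Icc t₀ τ, ∀ i j,
    Φ t i j = (1 : Matrix (Fin n) (Fin n) ℝ) i j + ∫ s in t₀..t, (S.A s (y s) (u s) * Φ s) i j

/-- `Ψ(t;t₀,y,u) = ∫_{t₀}^t Φ' C' C Φ ds`, for the fundamental matrix `Φ = Φ(·,t₀)`. -/
def Psi (t₀ : ℝ) (u : ℝ → Vec m) (Φ : ℝ → Matrix (Fin n) (Fin n) ℝ) (t : ℝ) :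
    Matrix (Fin n) (Fin n) ℝ :=
  Matrix.of fun i j => ∫ s in t₀..t, ((Φ s)ᵀ * (S.C s (u s))ᵀ * S.C s (u s) * Φ s) i j

/-- `Ξ(t;t₀,y,d,u)`, for the fundamental matrix `Φ = Φ(·,t₀)`; `Φ(t₀,s) = Φ(s,t₀)⁻¹`. -/
def Xi (t₀ : ℝ) (y : ℝ → Vec k) (u : ℝ → Vec m) (Φ : ℝ → Matrix (Fin n) (Fin n) ℝ)
    (d : ℝ → Vec n) (t : ℝ) : Vec n :=
  ∫ ρ in t₀..t, ((Φ ρ)ᵀ * (S.C ρ (u ρ))ᵀ * S.C ρ (u ρ) * Φ ρ).act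
    (∫ s in t₀..ρ, ((Φ s)⁻¹).act (S.f s (y s) (d s) (u s)))

/-- Condition A1 over `I`: `Ψ` is positive definite on `(t₀,τ]`. -/
def A1 (U : InputFamily m) (I : Set ℝ) : Prop :=
  I.Nonempty ∧ I ⊆ Ici 0 ∧
  ∀ t₀ ∈ I, ∃ δ > 0, ∀ τ ∈ Ioo t₀ (t₀ + δ), ∀ u ∈ U t₀ τ, ∀ y ∈ S.outputs t₀ τ u,
    ∃ Φ, S.IsFundamental t₀ τ y u Φ ∧ ∀ t ∈ Ioc t₀ τ, (S.Psi t₀ u Φ t).PosDef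

/-- Condition A2 over `I`: the contraction condition. -/
def A2 (U : InputFamily m) (I : Set ℝ) : Prop :=
  ∀ t₀ ∈ I, ∃ δ > 0, ∀ T ∈ Ioo t₀ (t₀ + δ), ∀ u ∈ U t₀ T, ∀ y ∈ S.outputs t₀ T u,
    ∃ Φ, S.IsFundamental t₀ T y u Φ ∧
      ∀ ℓ ∈ Ioo (0 : ℝ) 1, ∀ R > (0 : ℝ), ∀ θ > (0 : ℝ), ∃ τ ∈ Ioo t₀ (min (t₀ + θ) T),
        ∀ d₁ d₂ : ℝ → Vec n,
          ContinuousOn d₁ (Icc t₀ τ) → ContinuousOn d₂ (Icc t₀ τ) →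
          essNorm (Icc t₀ τ) d₁ ≤ ENNReal.ofReal R → essNorm (Icc t₀ τ) d₂ ≤ ENNReal.ofReal R →
          essNorm (Ioc t₀ τ)
              (fun t => ((S.Psi t₀ u Φ t)⁻¹).act (S.Xi t₀ y u Φ d₁ t - S.Xi t₀ y u Φ d₂ t))
            ≤ ENNReal.ofReal ℓ * essNorm (Icc t₀ τ) (fun t => d₁ t - d₂ t)

/-- The integral operator
`𝓕_T(t;t₀,y,z,u) = Φ(t,t₀) Ψ⁻¹(T) (∫_{t₀}^T Φ' C' y dρ - Ξ(T;z)) + ∫_{t₀}^t Φ(t,ρ) f(ρ,y,z,u) dρ`,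
with `Φ(t,ρ) = Φ(t,t₀) Φ(ρ,t₀)⁻¹`. -/
def iterOp (t₀ : ℝ) (y : ℝ → Vec k) (u : ℝ → Vec m) (Φ : ℝ → Matrix (Fin n) (Fin n) ℝ)
    (T : ℝ) (z : ℝ → Vec n) (t : ℝ) : Vec n :=
  (Φ t * (S.Psi t₀ u Φ T)⁻¹).act
      ((∫ ρ in t₀..T, ((Φ ρ)ᵀ * (S.C ρ (u ρ))ᵀ).act (y ρ)) - S.Xi t₀ y u Φ z T)
    + ∫ ρ in t₀..t, (Φ t * (Φ ρ)⁻¹).act (S.f ρ (y ρ) (z ρ) (u ρ))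

/-- The iteration scheme for given `t₀, τ, y, u`. For each `i` (a guess `i + 1` of a bound of the
unknown solution) it has radii `R_ν = (i+1) 2^ν`, times `t i ν ↓ t₀` in `(t₀,τ]` such that
`𝓕_{t i ν}` contracts with factor `1/2` on the ball of radius `R_ν`, and the iterates
`z i 0 = 0`, `z i (ν+1) = 𝓕_{t i ν}(z i ν)` on `[t₀, t i ν]`. No derivative of `y` or `u` and no
knowledge of the solution enters. -/
structure IsScheme (t₀ τ : ℝ) (y : ℝ → Vec k) (u : ℝ → Vec m)
    (Φ : ℝ → Matrix (Fin n) (Fin n) ℝ) (t : ℕ → ℕ → ℝ) (z : ℕ → ℕ → ℝ → Vec n) : Prop where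
  fundamental : S.IsFundamental t₀ τ y u Φ
  mem : ∀ i ν, t i ν ∈ Ioc t₀ τ
  anti : ∀ i, StrictAnti (t i)
  lim : ∀ i, Tendsto (t i) atTop (𝓝 t₀)
  diag : Tendsto (fun ν => t ν ν) atTop (𝓝 t₀)
  contraction : ∀ i ν, ∀ d₁ d₂ : ℝ → Vec n,
    ContinuousOn d₁ (Icc t₀ (t i ν)) → ContinuousOn d₂ (Icc t₀ (t i ν)) →
    essNorm (Icc t₀ (t i ν)) d₁ ≤ ENNReal.ofReal (((i : ℝ) + 1) * 2 ^ ν) →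
    essNorm (Icc t₀ (t i ν)) d₂ ≤ ENNReal.ofReal (((i : ℝ) + 1) * 2 ^ ν) →
    essNorm (Icc t₀ (t i ν))
        (fun s => S.iterOp t₀ y u Φ (t i ν) d₁ s - S.iterOp t₀ y u Φ (t i ν) d₂ s)
      ≤ ENNReal.ofReal (1 / 2) * essNorm (Icc t₀ (t i ν)) (fun s => d₁ s - d₂ s)
  init : ∀ i s, z i 0 s = 0
  step : ∀ i ν, ∀ s ∈ Icc t₀ (t i ν), z i (ν + 1) s = S.iterOp t₀ y u Φ (t i ν) (z i ν) s

/-- Functionals `X ν t₀ τ y u`, `ν = 0, 1, …`, solve the approximate state estimation problem over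
`I`: they depend on nothing but `t₀, τ` and the restrictions of `y`, `u` to `[t₀,τ]` (as elements
of `L_∞`), and `X ν t₀ τ y u → x₀`, where `x₀` is the unique initial state producing `y`. -/
def Estimates (U : InputFamily m) (I : Set ℝ)
    (X : ℕ → ℝ → ℝ → (ℝ → Vec k) → (ℝ → Vec m) → Vec n) : Prop :=
  (∀ ν t₀ τ y y' u u', y =ᵐ[volume.restrict (Icc t₀ τ)] y' →
    u =ᵐ[volume.restrict (Icc t₀ τ)] u' → X ν t₀ τ y u = X ν t₀ τ y' u') ∧
  ∀ t₀ ∈ I, ∃ δ > 0, ∀ τ ∈ Ioo t₀ (t₀ + δ), ∀ u ∈ U t₀ τ, ∀ y ∈ S.outputs t₀ τ u,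
    ∃ x₀, Tendsto (fun ν => X ν t₀ τ y u) atTop (𝓝 x₀) ∧
      S.Produces t₀ τ u x₀ y ∧ ∀ x₁, S.Produces t₀ τ u x₁ y → x₁ = x₀

/-- The functionals `X` are computed by the iteration scheme: `X ν = z_ν^ν(t_ν^ν)`. -/
def ComputedByScheme (U : InputFamily m) (I : Set ℝ)
    (X : ℕ → ℝ → ℝ → (ℝ → Vec k) → (ℝ → Vec m) → Vec n) : Prop :=
  ∀ t₀ ∈ I, ∃ δ > 0, ∀ τ ∈ Ioo t₀ (t₀ + δ), ∀ u ∈ U t₀ τ, ∀ y ∈ S.outputs t₀ τ u,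
    ∃ Φ t z, S.IsScheme t₀ τ y u Φ t z ∧ ∀ ν, X ν t₀ τ y u = z ν ν (t ν ν)

/-- The approximate state estimation problem is solvable over `I` by functionals that are free of
any differentiation of `y` and `u`, being computed by the integral iteration scheme. -/
def ApproxSEDPSolvable (U : InputFamily m) (I : Set ℝ) : Prop :=
  ∃ X : ℕ → ℝ → ℝ → (ℝ → Vec k) → (ℝ → Vec m) → Vec n,
    S.Estimates U I X ∧ S.ComputedByScheme U I X

end ControlSystem

/-- The data of a triangular system with state in `ℝⁿ`, `n = p + 1`, and input in `ℝᵐ`. In the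
numbering from `1`: `a i` is `a_{i+2}` and `f i` is `f_{i+1}` for `i = 0, …, p - 1`, and `fLast` is
`f_n`, so that `ẋ_i = a_{i+1}(t,x₁,u) x_{i+1} + f_i(t,x₁,u)` for `i < n`, and
`ẋ_n = f_n(t,x₁,…,x_n,u)`. -/
structure TriangularSystem (p m : ℕ) where
  a : Fin p → ℝ → ℝ → Vec m → ℝ
  f : Fin p → ℝ → ℝ → Vec m → ℝ
  fLast : ℝ → Vec (p + 1) → Vec m → ℝ

namespace TriangularSystem

variable {p m : ℕ} (S : TriangularSystem p m)

/-- The triangular system with output `y = x₁`, in the form `ẋ = A(t,y,u)x + f(t,y,x,u)`, `y = Cx`: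
`A` has the `a_i` on the superdiagonal, `C = [1 0 ⋯ 0]`, and everywhere in `f` the coordinate `x₁`
is the output `y`. -/
def toControlSystem : ControlSystem (p + 1) 1 m where
  A t y u := Matrix.of fun i j =>
    Fin.lastCases (motive := fun _ => ℝ) 0
      (fun i' : Fin p => if j = i'.succ then S.a i' t (y 0) u else 0) i
  f t y x u := WithLp.toLp 2 fun i =>
    Fin.lastCases (motive := fun _ => ℝ)
      (S.fLast t (WithLp.toLp 2 (Function.update x.ofLp 0 (y 0))) u)
      (fun i' : Fin p => S.f i' t (y 0) u) i
  C _ _ := Matrix.of fun _ j => if j = 0 then 1 else 0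

/-- The regularity assumptions. -/
structure Regular : Prop where
  a_meas : ∀ i y u, AEMeasurable (fun t => S.a i t y u) (volume.restrict (Ici 0))
  f_meas : ∀ i y u, AEMeasurable (fun t => S.f i t y u) (volume.restrict (Ici 0))
  fLast_meas : ∀ x u, AEMeasurable (fun t => S.fLast t x u) (volume.restrict (Ici 0))
  /-- the `a_i` are essentially bounded in `t`, locally uniformly in `(t, y, u)` -/
  a_bdd : ∀ i, ∀ r : ℝ, ∃ M : ℝ, ∀ᵐ t ∂(volume.restrict (Icc 0 r)),
    ∀ y u, |y| ≤ r → ‖u‖ ≤ r → |S.a i t y u| ≤ M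
  f_bdd : ∀ i y u, ∀ r : ℝ, ∃ M : ℝ, ∀ᵐ t ∂(volume.restrict (Icc 0 r)), |S.f i t y u| ≤ M
  fLast_bdd : ∀ x u, ∀ r : ℝ, ∃ M : ℝ, ∀ᵐ t ∂(volume.restrict (Icc 0 r)), |S.fLast t x u| ≤ M
  a_cont : ∀ i, ∀ t ≥ 0, Continuous fun q : ℝ × Vec m => S.a i t q.1 q.2
  f_cont : ∀ i, ∀ t ≥ 0, Continuous fun q : ℝ × Vec m => S.f i t q.1 q.2
  fLast_cont : ∀ t ≥ 0, Continuous fun q : Vec (p + 1) × Vec m => S.fLast t q.1 q.2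
  a_lip : ∀ i, ∀ t ≥ 0, ∀ u, LocallyLipschitz fun y => S.a i t y u
  f_lip : ∀ i, ∀ t ≥ 0, ∀ u, LocallyLipschitz fun y => S.f i t y u
  fLast_lip : ∀ t ≥ 0, ∀ u, LocallyLipschitz fun x => S.fLast t x u
  /-- `f_n` is Lipschitz in `(x₂,…,x_n)`, uniformly on bounded sets of `(t, x, u)` -/
  fLast_lip_unif : ∀ r : ℝ, ∃ L : ℝ, ∀ t ∈ Icc 0 r, ∀ u, ‖u‖ ≤ r → ∀ x x', ‖x‖ ≤ r → ‖x'‖ ≤ r →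
    x 0 = x' 0 → |S.fLast t x u - S.fLast t x' u| ≤ L * ‖x - x'‖

/-- The observability assumption on `I`, with `U_{[t₀,τ]} = L_∞([t₀,τ]; ℝᵐ)`. The value `y(t₀)` of an
output is that of its continuous representative. -/
def ObservabilityCondition (I : Set ℝ) : Prop :=
  MeasurableSet I ∧ I ⊆ Ici 0 ∧ (interior I).Nonempty ∧
  ∀ t₀ ∈ I, ∃ δ > 0, ∀ τ ∈ Ioo t₀ (t₀ + δ), ∀ u ∈ allInputs m t₀ τ,
    ∀ y ∈ S.toControlSystem.outputs t₀ τ u, ContinuousOn y (Icc t₀ τ) →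
      ∏ i, S.a i t₀ (y t₀ 0) (u t₀) ≠ 0

end TriangularSystem

end

open MeasureTheory Set Filter Topology
open scoped ENNReal Matrix

/-! Write `n = p + 1` and number components from `0`. The set sought consists of the points of `I`
that are right density points of every set `signSet` containing them. There are countably many such
sets, each null measurable, so almost every time qualifies. Since `I` has positive measure near each
of its points, removing a null set does not change its closure.

At such a `t₀`, altering the input at the single time `t₀` changes no solution, so the observability
condition says that no coefficient vanishes at `(t₀, x₁(t₀), v)` for any `v`. By connectedness each
coefficient has one sign in `v`. By compactness it is bounded away from zero for bounded `v` and
nearby outputs. Density then makes the coefficients along the output of constant sign and at least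
`c` in absolute value on `[t₀, t₀ + h]`, off a set of measure at most `ε h`.

Two opposite estimates follow for the chain `x_i' = b_i x_{i+1} + g_i`. The lower bound
`exists_abs_zero_lower_bound` shows that an unforced solution has first component comparable to `∑
h^j |x_j(t₀)|` on a subinterval of length comparable to `h`. Hence the Gramian is positive definite,
and its inverse loses at most `h^p` relative to a uniform bound on the data (`gram_solution_bound`).
The upper bound `SolvesChain.abs_zero_le` shows that a forcing of size `G` in the last component
alone moves the first component by at most a multiple of `h^(p+1) G`. Replacing `d₁` by `d₂` changes
exactly that last forcing term. One factor `h` is left over, so `Ψ⁻¹ΔΞ` and the operators `𝓕_T` have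
Lipschitz constant `K (T - t₀)` on each ball (`Tame.contraction`).

A solution with output `y` is a fixed point of every `𝓕_T` (`Tame.iterOp_eq_self`). Once `i + 1` is
at least twice a bound of that solution, the iterates of scheme `i` never leave the ball on which
the operator contracts, and the error is halved at each step. Along the diagonal the guess `i = ν`
is eventually large enough, so `z_ν^ν(t_ν^ν)` tends to the initial state. Uniqueness is a
consequence: every initial state producing `y` is the limit of the same sequence. -/

/-! ### Measurability, products of primitives and density points -/

/-- A Carathéodory function composed with a measurable function is measurable. -/
theorem aemeasurable_caratheodory {X : Type*} [TopologicalSpace X] [TopologicalSpace.PseudoMetrizableSpace X]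
    [MeasurableSpace X] [BorelSpace X] [SecondCountableTopology X] {μ : Measure ℝ} {g : ℝ → X → ℝ}
    (hg : ∀ x, AEMeasurable (fun t => g t x) μ) (hc : ∀ᵐ t ∂μ, Continuous (g t))
    {φ : ℝ → X} (hφ : AEMeasurable φ μ) : AEMeasurable (fun t => g t (φ t)) μ := by
  have hs : AEStronglyMeasurable φ μ := hφ.aestronglyMeasurable
  set ψ := hs.mk φ with hψ
  have hsm : StronglyMeasurable ψ := hs.stronglyMeasurable_mk
  have hsimple : ∀ k : SimpleFunc ℝ X, AEMeasurable (fun t => g t (k t)) μ := by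
    intro k
    have hcov : (⋃ x : k.range, k ⁻¹' {(x : X)}) = univ := by
      ext t
      simp
    rw [← Measure.restrict_univ (μ := μ), ← hcov, aemeasurable_iUnion_iff]
    intro x
    refine ((hg x).mono_measure Measure.restrict_le_self).congr ?_
    filter_upwards [ae_restrict_mem (k.measurableSet_fiber x)] with t ht
    simp only [mem_preimage, mem_singleton_iff] at ht
    simp [ht]
  refine aemeasurable_of_tendsto_metrizable_ae atTop (fun k => hsimple (hsm.approx k)) ?_
  filter_upwards [hc, hs.ae_eq_mk] with t ht hφt
  rw [hφt]
  exact (ht.tendsto _).comp (hsm.tendsto_approx t)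

/-- The product rule for primitives of integrable functions, in integrated form. -/
theorem mul_eq_add_integral_of_primitive {F G f g : ℝ → ℝ} {F₀ G₀ a b : ℝ} (hab : a ≤ b)
    (hf : IntervalIntegrable f volume a b) (hg : IntervalIntegrable g volume a b)
    (hF : ∀ t ∈ Icc a b, F t = F₀ + ∫ s in a..t, f s)
    (hG : ∀ t ∈ Icc a b, G t = G₀ + ∫ s in a..t, g s) {t : ℝ} (ht : t ∈ Icc a b) :
    F t * G t = F₀ * G₀ + ∫ s in a..t, (f s * G s + F s * g s) := by
  have hsub : uIcc a t ⊆ uIcc a b := by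
    rw [uIcc_of_le hab, uIcc_of_le ht.1]; exact Icc_subset_Icc_right ht.2
  have hf' := hf.mono_set hsub
  have hg' := hg.mono_set hsub
  have key : ∀ {f : ℝ → ℝ} (c : ℝ), IntervalIntegrable f volume a t →
      AbsolutelyContinuousOnInterval (fun r => c + ∫ s in a..r, f s) a t := by
    intro f c hf
    have h1 : AbsolutelyContinuousOnInterval (fun _ : ℝ => c) a t :=
      (LipschitzWith.const c).lipschitzOnWith.absolutelyContinuousOnInterval
    exact h1.add (hf.absolutelyContinuousOnInterval_intervalIntegral (by simp))
  have hF1 := key F₀ hf'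
  have hG1 := key G₀ hg'
  have h := AbsolutelyContinuousOnInterval.integral_deriv_mul_eq_sub hF1 hG1
  have h2 : ∫ s in a..t, (f s * G s + F s * g s) = F t * G t - F₀ * G₀ := by
    rw [hF t ht, hG t ht]
    simp only [intervalIntegral.integral_same, add_zero] at h
    rw [← h]
    apply intervalIntegral.integral_congr_ae
    filter_upwards [hf'.ae_hasDerivAt_integral, hg'.ae_hasDerivAt_integral] with s hs1 hs2 hs
    have hs' : s ∈ uIcc a t := uIoc_subset_uIcc hs
    have hsI : s ∈ Icc a b := by
      have := hsub hs'; rwa [uIcc_of_le hab] at this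
    rw [((hs1 hs' a (by simp)).const_add F₀).deriv, ((hs2 hs' a (by simp)).const_add G₀).deriv,
      hF s hsI, hG s hsI]
  rw [h2]; ring

/-- Almost every point of a null measurable set is a point of right density. -/
theorem ae_right_density {ι : Type*} [Countable ι] (E : ι → Set ℝ)
    (hE : ∀ k, NullMeasurableSet (E k)) :
    ∀ᵐ t : ℝ, ∀ k, t ∈ E k → ∀ ε > 0, ∀ᶠ h in 𝓝[>] (0 : ℝ),
      volume (Icc t (t + h) \ E k) ≤ ENNReal.ofReal (ε * h) := by
  rw [ae_all_iff]
  intro k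
  have h := Besicovitch.ae_tendsto_measure_inter_div (volume : Measure ℝ) (E k)
  have h' := (ae_restrict_iff'₀ (hE k)).1 h
  filter_upwards [h'] with t ht htE ε hε
  have hlim := ht htE
  -- The centred ball has length `2h`, so a missing fraction `ε / 2` amounts to measure `ε h`, which
  -- also bounds what is missing from its right half.
  have hev : ∀ᶠ h in 𝓝[>] (0 : ℝ), ENNReal.ofReal (1 - ε / 2) <
      volume (E k ∩ Metric.closedBall t h) / volume (Metric.closedBall t h) := by
    refine hlim.eventually (lt_mem_nhds ?_)
    rw [ENNReal.ofReal_lt_one]; linarith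
  filter_upwards [hev, self_mem_nhdsWithin] with r hr hr0
  have hr0 : 0 < r := hr0
  rw [Real.volume_closedBall] at hr
  have h2 : ENNReal.ofReal (1 - ε / 2) * ENNReal.ofReal (2 * r) ≤
      volume (E k ∩ Metric.closedBall t r) :=
    (ENNReal.le_div_iff_mul_le (Or.inl (by simp [hr0])) (Or.inl ENNReal.ofReal_ne_top)).1 hr.le
  have h3 : volume (Metric.closedBall t r \ E k) ≤ ENNReal.ofReal (ε * r) := by
    have h4 := measure_inter_add_sdiff₀ (μ := volume) (Metric.closedBall t r) (hE k)
    rw [Real.volume_closedBall, inter_comm] at h4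
    have hfin : volume (E k ∩ Metric.closedBall t r) ≠ ∞ :=
      ((measure_mono inter_subset_right).trans_lt measure_closedBall_lt_top).ne
    have h5 : volume (Metric.closedBall t r \ E k) ≤
        ENNReal.ofReal (2 * r) - volume (E k ∩ Metric.closedBall t r) := by
      rw [← h4, ENNReal.add_sub_cancel_left hfin]
    refine h5.trans ((tsub_le_tsub_left h2 _).trans ?_)
    rcases le_total 0 (1 - ε / 2) with h6 | h6
    · rw [← ENNReal.ofReal_mul h6, ← ENNReal.ofReal_sub _ (by positivity)]
      apply ENNReal.ofReal_le_ofReal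
      nlinarith
    · rw [ENNReal.ofReal_of_nonpos h6, zero_mul, tsub_zero]
      apply ENNReal.ofReal_le_ofReal
      nlinarith
  refine (measure_mono ?_).trans h3
  rw [Real.closedBall_eq_Icc]
  exact sdiff_subset_sdiff_left (Icc_subset_Icc (by linarith) le_rfl)

/-- Sublevel sets of Carathéodory functions, uniformly over a set of parameters. -/
theorem nullMeasurableSet_forall_le {X : Type*} [TopologicalSpace X] [SecondCountableTopology X]
    {S : Set ℝ} (hS : MeasurableSet S) {g : ℝ → X → ℝ}
    (hg : ∀ x, AEMeasurable (fun t => g t x) (volume.restrict S))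
    (hc : ∀ t ∈ S, Continuous (g t)) (K : Set X) (q : ℝ) :
    NullMeasurableSet {t | t ∈ S ∧ ∀ x ∈ K, q ≤ g t x} := by
  -- By continuity in the parameter, a countable dense subset of `K` decides the condition.
  obtain ⟨D, hDc, hD⟩ := TopologicalSpace.exists_countable_dense K
  have heq : {t | t ∈ S ∧ ∀ x ∈ K, q ≤ g t x} = S ∩ ⋂ x ∈ D, {t | q ≤ g t x} ∩ S := by
    ext t
    simp only [mem_ofPred_eq, mem_inter_iff, mem_iInter]
    refine ⟨fun h => ⟨h.1, fun x _ => ⟨h.2 x x.2, h.1⟩⟩, fun h => ⟨h.1, fun x hx => ?_⟩⟩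
    have hcl : IsClosed {x : K | q ≤ g t x} :=
      isClosed_le continuous_const ((hc t h.1).comp continuous_subtype_val)
    have : closure D ⊆ {x : K | q ≤ g t x} := hcl.closure_subset_iff.2 fun x hx => (h.2 x hx).1
    exact this (hD ⟨x, hx⟩)
  rw [heq]
  refine hS.nullMeasurableSet.inter (NullMeasurableSet.biInter hDc fun x _ => ?_)
  rw [← nullMeasurableSet_restrict hS.nullMeasurableSet]
  exact nullMeasurableSet_le aemeasurable_const (hg x)

/-! ### Chains of integral equations and their growth -/

/-- `x` solves `x_i' = b_i x_{i+1} + g_i` for `i < p` and `x_p' = g_p` on `[t₀,T]`. -/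
structure SolvesChain {p : ℕ} (t₀ T : ℝ) (b : Fin p → ℝ → ℝ) (g x : Fin (p + 1) → ℝ → ℝ) : Prop where
  cont : ∀ i, ContinuousOn (x i) (Icc t₀ T)
  step : ∀ i : Fin p, ∀ t ∈ Icc t₀ T, x i.castSucc t =
    x i.castSucc t₀ + ∫ s in t₀..t, (b i s * x i.succ s + g i.castSucc s)
  last : ∀ t ∈ Icc t₀ T, x (Fin.last p) t = x (Fin.last p) t₀ + ∫ s in t₀..t, g (Fin.last p) s

/-- The coefficients `b_i` are measurable and essentially bounded by `M` on `[t₀,T]`. -/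
structure BoundedCoeff {p : ℕ} (t₀ T M : ℝ) (b : Fin p → ℝ → ℝ) : Prop where
  meas : ∀ i, AEStronglyMeasurable (b i) (volume.restrict (Icc t₀ T))
  bdd : ∀ i, ∀ᵐ s ∂(volume.restrict (Icc t₀ T)), |b i s| ≤ M

theorem BoundedCoeff.mono {p : ℕ} {t₀ T T' M : ℝ} {b : Fin p → ℝ → ℝ} (h : BoundedCoeff t₀ T M b)
    (hT : T' ≤ T) : BoundedCoeff t₀ T' M b :=
  ⟨fun i => (h.meas i).mono_measure (Measure.restrict_mono (Icc_subset_Icc_right hT) le_rfl),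
    fun i => ae_mono (Measure.restrict_mono (Icc_subset_Icc_right hT) le_rfl) (h.bdd i)⟩

theorem BoundedCoeff.tail {p : ℕ} {t₀ T M : ℝ} {b : Fin (p + 1) → ℝ → ℝ}
    (h : BoundedCoeff t₀ T M b) : BoundedCoeff t₀ T M (fun i : Fin p => b i.succ) :=
  ⟨fun i => h.meas i.succ, fun i => h.bdd i.succ⟩

theorem BoundedCoeff.intervalIntegrable_mul {p : ℕ} {t₀ T M : ℝ} {b : Fin p → ℝ → ℝ}
    (h : BoundedCoeff t₀ T M b) (i : Fin p) {x : ℝ → ℝ} (hx : ContinuousOn x (Icc t₀ T))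
    {r t : ℝ} (hr : r ∈ Icc t₀ T) (ht : t ∈ Icc t₀ T) :
    IntervalIntegrable (fun s => b i s * x s) volume r t := by
  have hsub : uIcc r t ⊆ Icc t₀ T := ordConnected_Icc.uIcc_subset hr ht
  have h1 : IntegrableOn (b i) (Icc t₀ T) :=
    ⟨h.meas i, HasFiniteIntegral.of_bounded (h.bdd i)⟩
  have h2 : IntervalIntegrable (b i) volume r t := (h1.mono_set hsub).intervalIntegrable
  exact h2.mul_continuousOn (hx.mono hsub)

theorem abs_integral_le_of_ae_Icc {t₀ T t C : ℝ} {f : ℝ → ℝ} (ht : t ∈ Icc t₀ T) (hC : 0 ≤ C)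
    (hf : ∀ᵐ s ∂(volume.restrict (Icc t₀ T)), |f s| ≤ C) :
    |∫ s in t₀..t, f s| ≤ C * (T - t₀) := by
  have h := intervalIntegral.norm_integral_le_of_norm_le_const_ae (a := t₀) (b := t) (f := f)
    (C := C) (by
      filter_upwards [(ae_restrict_iff' measurableSet_Icc).1 hf] with s hs hs'
      rw [uIoc_of_le ht.1] at hs'
      exact hs ⟨hs'.1.le, hs'.2.trans ht.2⟩)
  rw [Real.norm_eq_abs, abs_of_nonneg (sub_nonneg.2 ht.1)] at h
  exact h.trans (mul_le_mul_of_nonneg_left (by linarith [ht.2]) hC)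

namespace SolvesChain

theorem mono {p : ℕ} {t₀ T T' : ℝ} {b : Fin p → ℝ → ℝ} {g x : Fin (p + 1) → ℝ → ℝ}
    (h : SolvesChain t₀ T b g x) (hT : T' ≤ T) : SolvesChain t₀ T' b g x :=
  ⟨fun i => (h.cont i).mono (Icc_subset_Icc_right hT),
    fun i t ht => h.step i t (Icc_subset_Icc_right hT ht),
    fun t ht => h.last t (Icc_subset_Icc_right hT ht)⟩

theorem tail {p : ℕ} {t₀ T : ℝ} {b : Fin (p + 1) → ℝ → ℝ} {g x : Fin (p + 2) → ℝ → ℝ}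
    (h : SolvesChain t₀ T b g x) :
    SolvesChain t₀ T (fun i : Fin p => b i.succ) (fun i => g i.succ) (fun i => x i.succ) :=
  ⟨fun i => h.cont i.succ, fun i => h.step i.succ, h.last⟩

/-- Two solutions of a chain with the same initial values agree. -/
theorem eqOn {p : ℕ} {t₀ T : ℝ} {b : Fin p → ℝ → ℝ} {g x x' : Fin (p + 1) → ℝ → ℝ}
    (h : SolvesChain t₀ T b g x) (h' : SolvesChain t₀ T b g x') (h0 : ∀ i, x i t₀ = x' i t₀) (i) :
    EqOn (x i) (x' i) (Icc t₀ T) := by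
  induction i using Fin.reverseInduction with
  | last => intro t ht; rw [h.last t ht, h'.last t ht, h0]
  | cast i ih =>
    intro t ht
    rw [h.step i t ht, h'.step i t ht, h0]
    congr 1
    apply intervalIntegral.integral_congr
    intro s hs
    rw [uIcc_of_le ht.1] at hs
    simp only
    rw [ih ⟨hs.1, hs.2.trans ht.2⟩]

variable {t₀ T M G : ℝ}

/-- The `j`-th initial value reaches the first component after `j` integrations, hence the weight
`(T - t₀) ^ j`; the forcing acts on the last component only and needs `p + 1` of them. These exact
powers are what the contraction estimate depends on. -/
theorem abs_zero_le (hT : t₀ ≤ T) (hM : 1 ≤ M) (hG : 0 ≤ G) :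
    ∀ {p : ℕ} {b : Fin p → ℝ → ℝ} {g x : Fin (p + 1) → ℝ → ℝ}, SolvesChain t₀ T b g x →
    BoundedCoeff t₀ T M b → (∀ (i : Fin p) s, g i.castSucc s = 0) →
    (∀ᵐ s ∂(volume.restrict (Icc t₀ T)), |g (Fin.last p) s| ≤ G) → ∀ t ∈ Icc t₀ T,
    |x 0 t| ≤ M ^ p * (∑ j : Fin (p + 1), (T - t₀) ^ (j : ℕ) * |x j t₀| + (T - t₀) ^ (p + 1) * G) := by
  have hh : 0 ≤ T - t₀ := sub_nonneg.2 hT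
  intro p
  induction p with
  | zero =>
    intro b g x hx _ _ hg t ht
    have h1 := abs_integral_le_of_ae_Icc ht hG hg
    have h2 := hx.last t ht
    simp only [Fin.last_zero] at h1 h2
    rw [h2]
    refine (abs_add_le _ _).trans ?_
    simp
    linarith
  | succ p ih =>
    intro b g x hx hb hg0 hg t ht
    have h1 := ih hx.tail hb.tail (fun i s => hg0 i.succ s) hg
    rw [Fin.sum_univ_succ]
    set N' := ∑ j : Fin (p + 1), (T - t₀) ^ (j : ℕ) * |x j.succ t₀| with hN'
    set D := N' + (T - t₀) ^ (p + 1) * G with hD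
    have hD0 : 0 ≤ D := by positivity
    have h2 := hx.step 0 t ht
    rw [Fin.castSucc_zero] at h2
    have h3 : |∫ s in t₀..t, (b 0 s * x (Fin.succ 0) s + g 0 s)| ≤ M * (M ^ p * D) * (T - t₀) := by
      refine abs_integral_le_of_ae_Icc ht (by positivity) ?_
      filter_upwards [hb.bdd 0, ae_restrict_mem measurableSet_Icc] with s hs hs'
      have := hg0 0 s
      rw [Fin.castSucc_zero] at this
      rw [this, add_zero, abs_mul]
      exact mul_le_mul hs (h1 s hs') (abs_nonneg _) (by linarith)
    have h4 : ∑ j : Fin (p + 1), (T - t₀) ^ ((j.succ : Fin (p + 2)) : ℕ) * |x j.succ t₀| =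
        (T - t₀) * N' := by
      rw [hN', Finset.mul_sum]
      refine Finset.sum_congr rfl fun j _ => ?_
      rw [Fin.val_succ, pow_succ]; ring
    rw [h4, h2]
    refine (abs_add_le _ _).trans ?_
    have h5 : 1 ≤ M ^ (p + 1) := one_le_pow₀ hM
    have h6 : |x 0 t₀| ≤ M ^ (p + 1) * |x 0 t₀| := le_mul_of_one_le_left (abs_nonneg _) h5
    simp only [Fin.val_zero, pow_zero, one_mul]
    calc _ ≤ M ^ (p + 1) * |x 0 t₀| + M * (M ^ p * D) * (T - t₀) := add_le_add h6 h3
      _ = _ := by rw [hD]; ring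

/-- A coarser bound serves for the remaining components: on an interval of length at most one,
positive powers of the length may be replaced by lower ones, and each tail of the chain is again a
chain. -/
theorem abs_le (hT : t₀ ≤ T) (hT1 : T ≤ t₀ + 1) (hM : 1 ≤ M) (hG : 0 ≤ G) :
    ∀ {p : ℕ} {b : Fin p → ℝ → ℝ} {g x : Fin (p + 1) → ℝ → ℝ}, SolvesChain t₀ T b g x →
    BoundedCoeff t₀ T M b → (∀ (i : Fin p) s, g i.castSucc s = 0) →
    (∀ᵐ s ∂(volume.restrict (Icc t₀ T)), |g (Fin.last p) s| ≤ G) → ∀ i, ∀ t ∈ Icc t₀ T,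
    |x i t| ≤ M ^ p * (∑ j, |x j t₀| + (T - t₀) * G) := by
  have hh : 0 ≤ T - t₀ := sub_nonneg.2 hT
  have hh1 : T - t₀ ≤ 1 := by linarith
  have hzero : ∀ {p : ℕ} {b : Fin p → ℝ → ℝ} {g x : Fin (p + 1) → ℝ → ℝ}, SolvesChain t₀ T b g x →
      BoundedCoeff t₀ T M b → (∀ (i : Fin p) s, g i.castSucc s = 0) →
      (∀ᵐ s ∂(volume.restrict (Icc t₀ T)), |g (Fin.last p) s| ≤ G) → ∀ t ∈ Icc t₀ T,
      |x 0 t| ≤ M ^ p * (∑ j, |x j t₀| + (T - t₀) * G) := by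
    intro p b g x hx hb hg0 hg t ht
    refine (hx.abs_zero_le hT hM hG hb hg0 hg t ht).trans ?_
    gcongr with j
    · exact mul_le_of_le_one_left (abs_nonneg _) (pow_le_one₀ hh hh1)
    · exact pow_le_of_le_one hh hh1 (by omega)
  intro p
  induction p with
  | zero =>
    intro b g x hx hb hg0 hg i
    rw [Fin.fin_one_eq_zero i]
    exact hzero hx hb hg0 hg
  | succ p ih =>
    intro b g x hx hb hg0 hg i
    refine Fin.cases (hzero hx hb hg0 hg) (fun i => ?_) i
    intro t ht
    refine (ih hx.tail hb.tail (fun i s => hg0 i.succ s) hg i t ht).trans ?_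
    gcongr
    · omega
    · rw [Fin.sum_univ_succ (fun j => |x j t₀|)]
      exact le_add_of_nonneg_left (abs_nonneg _)

end SolvesChain

/-! ### Quantitative observability of the homogeneous chain -/

/-- If the coefficients of a homogeneous chain on `[t₀,t₀+h]` are bounded and, off a set of small
relative measure, of constant sign and bounded away from zero, then the first component is large
on a subinterval of length comparable to `h`. -/
theorem exists_abs_zero_lower_bound {c M : ℝ} (hc : 0 < c) (hM : 1 ≤ M) (p : ℕ) :
    ∃ κ > 0, ∃ ε > 0, ∀ (t₀ h : ℝ) (b : Fin p → ℝ → ℝ) (x : Fin (p + 1) → ℝ → ℝ) (σ : Fin p → ℝ)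
      (B : Set ℝ), 0 < h → SolvesChain t₀ (t₀ + h) b (fun _ _ => 0) x →
      BoundedCoeff t₀ (t₀ + h) M b → MeasurableSet B →
      volume (Icc t₀ (t₀ + h) ∩ B) ≤ ENNReal.ofReal (ε * h) → (∀ i, σ i = 1 ∨ σ i = -1) →
      (∀ i, ∀ᵐ s ∂(volume.restrict (Icc t₀ (t₀ + h))), s ∉ B → c ≤ σ i * b i s) →
      ∃ α β τ : ℝ, t₀ ≤ α ∧ β ≤ t₀ + h ∧ κ * h ≤ β - α ∧ (τ = 1 ∨ τ = -1) ∧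
        ∀ s ∈ Icc α β, κ * ∑ j : Fin (p + 1), h ^ (j : ℕ) * |x j t₀| ≤ τ * x 0 s := by
  induction p with
  | zero =>
    refine ⟨1, one_pos, 1, one_pos, fun t₀ h b x σ B hh hx _ _ _ _ _ => ?_⟩
    have hconst : ∀ s ∈ Icc t₀ (t₀ + h), x 0 s = x 0 t₀ := by
      intro s hs
      have := hx.last s hs
      simpa using this
    rcases le_total 0 (x 0 t₀) with h0 | h0
    · refine ⟨t₀, t₀ + h, 1, le_rfl, le_rfl, by linarith, Or.inl rfl, fun s hs => ?_⟩
      simp [hconst s hs, abs_of_nonneg h0]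
    · refine ⟨t₀, t₀ + h, -1, le_rfl, le_rfl, by linarith, Or.inr rfl, fun s hs => ?_⟩
      simp [hconst s hs, abs_of_nonpos h0]
  | succ p ih =>
    obtain ⟨κ, hκ, ε, hε, ih⟩ := ih
    set Q := M ^ (p + 1) with hQ
    have hQ1 : 1 ≤ Q := one_le_pow₀ hM
    -- Over a third of the interval from the induction hypothesis, the first component gains `c κ² /
    -- 3` in units of `h N'`; the choice of `ε'` below caps the loss on the exceptional set at `c κ²
    -- / 6`. What remains is `2 μ`.
    set μ := c * κ ^ 2 / 12 with hμ
    have hμ0 : 0 < μ := by positivity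
    -- The three bounds serve in turn the case of a dominant initial value, the length of one third
    -- of the interval, and the case of a small initial value.
    set κ' := min (1 / 4) (min (κ / 3) (μ / (2 * Q + 1))) with hκ'
    have hκ'0 : 0 < κ' := by positivity
    have hκ1 : κ' ≤ 1 / 4 := min_le_left _ _
    have hκ2 : κ' ≤ κ / 3 := (min_le_right _ _).trans (min_le_left _ _)
    have hκ3 : κ' * (2 * Q + 1) ≤ μ := by
      rw [← le_div_iff₀ (by positivity)]
      exact (min_le_right _ _).trans (min_le_right _ _)
    set ε' := min ε (c * κ ^ 2 / (6 * (c * κ + Q))) with hε'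
    have hε1 : ε' ≤ ε := min_le_left _ _
    have hε2 : (c * κ + Q) * ε' ≤ c * κ ^ 2 / 6 := by
      have : ε' * (6 * (c * κ + Q)) ≤ c * κ ^ 2 := by
        rw [← le_div_iff₀ (by positivity)]
        exact min_le_right _ _
      linarith
    refine ⟨κ', hκ'0, ε', by positivity, fun t₀ h b x σ B hh hx hb hB hvol hσ hlow => ?_⟩
    obtain ⟨α, β, τ, hα, hβ, hαβ, hτ, hx1⟩ := ih t₀ h _ _ (fun i => σ i.succ) B hh hx.tail hb.tail hB
      (hvol.trans (ENNReal.ofReal_le_ofReal (mul_le_mul_of_nonneg_right hε1 hh.le)))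
      (fun i => hσ i.succ) (fun i => hlow i.succ)
    rw [Fin.sum_univ_succ]
    set N' := ∑ j : Fin (p + 1), h ^ (j : ℕ) * |x j.succ t₀| with hN'
    have hN0 : 0 ≤ N' := by positivity
    have h4 : ∑ j : Fin (p + 1), h ^ ((j.succ : Fin (p + 2)) : ℕ) * |x j.succ t₀| = h * N' := by
      rw [hN', Finset.mul_sum]
      refine Finset.sum_congr rfl fun j _ => ?_
      rw [Fin.val_succ, pow_succ]; ring
    rw [h4]
    simp only [Fin.val_zero, pow_zero, one_mul]
    have hup : ∀ s ∈ Icc t₀ (t₀ + h), |x (Fin.succ 0) s| ≤ M ^ p * N' := by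
      intro s hs
      have := hx.tail.abs_zero_le (G := 0) (by linarith) hM le_rfl hb.tail (fun _ _ => rfl)
        (by simp) s hs
      simpa using this
    have hαβ' : α < β := by nlinarith
    have hsub : Icc α β ⊆ Icc t₀ (t₀ + h) := Icc_subset_Icc hα hβ
    have hprod : ∀ᵐ s ∂(volume.restrict (Icc t₀ (t₀ + h))), |b 0 s * x (Fin.succ 0) s| ≤ Q * N' := by
      filter_upwards [hb.bdd 0, ae_restrict_mem measurableSet_Icc] with s hs hs'
      rw [abs_mul]
      calc _ ≤ M * (M ^ p * N') := mul_le_mul hs (hup s hs') (abs_nonneg _) (by linarith)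
        _ = _ := by rw [hQ]; ring
    have hstep : ∀ t ∈ Icc t₀ (t₀ + h), x 0 t = x 0 t₀ + ∫ s in t₀..t, b 0 s * x (Fin.succ 0) s := by
      intro t ht
      have := hx.step 0 t ht
      simpa using this
    -- The first component can change by at most `Q h N'` in total. If its initial value is at least
    -- twice that, it keeps its sign and half its size throughout.
    by_cases hcase : 2 * Q * (h * N') ≤ |x 0 t₀|
    · have hbd : ∀ s ∈ Icc t₀ (t₀ + h), |x 0 s - x 0 t₀| ≤ |x 0 t₀| / 2 := by
        intro s hs
        rw [hstep s hs, add_sub_cancel_left]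
        have := abs_integral_le_of_ae_Icc hs (by positivity) hprod
        rw [add_sub_cancel_left] at this
        nlinarith
      have hN : |x 0 t₀| + h * N' ≤ 2 * |x 0 t₀| := by
        have : h * N' ≤ Q * (h * N') := le_mul_of_one_le_left (by positivity) hQ1
        nlinarith [abs_nonneg (x 0 t₀)]
      have hfin : κ' * (|x 0 t₀| + h * N') ≤ |x 0 t₀| / 2 := by
        calc _ ≤ 1 / 4 * (2 * |x 0 t₀|) := by gcongr
          _ = _ := by ring
      have hlen : κ' * h ≤ t₀ + h - t₀ := by nlinarith
      rcases le_total 0 (x 0 t₀) with h0 | h0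
      · refine ⟨t₀, t₀ + h, 1, le_rfl, le_rfl, hlen, Or.inl rfl, fun s hs => hfin.trans ?_⟩
        have := (_root_.abs_le.1 (hbd s hs)).1
        rw [abs_of_nonneg h0] at this ⊢
        linarith
      · refine ⟨t₀, t₀ + h, -1, le_rfl, le_rfl, hlen, Or.inr rfl, fun s hs => hfin.trans ?_⟩
        have := (_root_.abs_le.1 (hbd s hs)).2
        rw [abs_of_nonpos h0] at this ⊢
        linarith
    · push Not at hcase
      have hN : κ' * (|x 0 t₀| + h * N') ≤ μ * (h * N') := by
        have : κ' * (|x 0 t₀| + h * N') ≤ κ' * ((2 * Q + 1) * (h * N')) := by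
          gcongr; linarith
        nlinarith [mul_le_mul_of_nonneg_right hκ3 (show 0 ≤ h * N' by positivity)]
      set ω := σ 0 * τ with hω
      have hω1 : ω = 1 ∨ ω = -1 := by
        rcases hσ 0 with h1 | h1 <;> rcases hτ with h2 | h2 <;> simp [hω, h1, h2]
      -- Otherwise monotonicity up to a small error is used: off `B` the derivative of `ω x₀` is at
      -- least `m`, and on `B` it is at least `-Q N'`.
      have hinc : ∀ s ∈ Icc α β, ∀ t ∈ Icc α β, (β - α) / 3 ≤ t - s →
          2 * (μ * (h * N')) ≤ ω * x 0 t - ω * x 0 s := by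
        intro s hs t ht hst
        have hst' : s ≤ t := by linarith
        have hsT := hsub hs
        have htT := hsub ht
        have hint : ∀ {r t}, r ∈ Icc t₀ (t₀ + h) → t ∈ Icc t₀ (t₀ + h) →
            IntervalIntegrable (fun s => b 0 s * x (Fin.succ 0) s) volume r t :=
          fun hr ht => hb.intervalIntegrable_mul 0 (hx.cont _) hr ht
        have ht0 : t₀ ∈ Icc t₀ (t₀ + h) := ⟨le_rfl, by linarith⟩
        have hdiff : ω * x 0 t - ω * x 0 s = ∫ r in s..t, ω * (b 0 r * x (Fin.succ 0) r) := by
          rw [intervalIntegral.integral_const_mul, hstep t htT, hstep s hsT,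
            ← intervalIntegral.integral_interval_sub_left (hint ht0 htT) (hint ht0 hsT)]
          ring
        set m := c * (κ * N') with hm
        have hm0 : 0 ≤ m := by positivity
        have hIndInt : IntervalIntegrable (fun r => m - (m + Q * N') * B.indicator (fun _ => (1 : ℝ)) r)
            volume s t := by
          refine intervalIntegrable_const.sub (IntervalIntegrable.const_mul ?_ _)
          exact (intervalIntegrable_iff.2 ((integrableOn_const (by simp)).indicator hB))
        have hlb : ∫ r in s..t, (m - (m + Q * N') * B.indicator (fun _ => (1 : ℝ)) r) ≤
            ∫ r in s..t, ω * (b 0 r * x (Fin.succ 0) r) := by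
          refine intervalIntegral.integral_mono_ae_restrict hst' hIndInt
            ((hint hsT htT).const_mul ω) ?_
          have hle : volume.restrict (Icc s t) ≤ volume.restrict (Icc t₀ (t₀ + h)) :=
            Measure.restrict_mono (Icc_subset_Icc hsT.1 htT.2) le_rfl
          filter_upwards [ae_mono hle hprod, ae_mono hle (hlow 0),
            ae_restrict_mem measurableSet_Icc] with r hr1 hr2 hr3
          have hr4 : κ * N' ≤ τ * x (Fin.succ 0) r := hx1 r ⟨hs.1.trans hr3.1, hr3.2.trans ht.2⟩
          by_cases hrB : r ∈ B
          · rw [indicator_of_mem hrB]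
            have habs : |ω * (b 0 r * x (Fin.succ 0) r)| ≤ Q * N' := by
              rw [abs_mul]
              have : |ω| = 1 := by rcases hω1 with h1 | h1 <;> simp [h1]
              rw [this, one_mul]; exact hr1
            have := (_root_.abs_le.1 habs).1
            linarith
          · rw [indicator_of_notMem hrB]
            have h5 := hr2 hrB
            have : m ≤ (σ 0 * b 0 r) * (τ * x (Fin.succ 0) r) := by
              rw [hm]
              exact mul_le_mul h5 hr4 (by positivity) (hc.le.trans h5)
            calc _ = m := by ring
              _ ≤ _ := this
              _ = _ := by rw [hω]; ring
        have hval : ∫ r in s..t, (m - (m + Q * N') * B.indicator (fun _ => (1 : ℝ)) r) =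
            m * (t - s) - (m + Q * N') * (volume.real (B ∩ Ioc s t)) := by
          have hI : ∫ r in s..t, B.indicator (fun _ => (1 : ℝ)) r = volume.real (B ∩ Ioc s t) := by
            rw [intervalIntegral.integral_of_le hst', integral_indicator hB,
              Measure.restrict_restrict hB]
            simp
          rw [intervalIntegral.integral_sub intervalIntegrable_const
            (IntervalIntegrable.const_mul (intervalIntegrable_iff.2
              ((integrableOn_const (by simp)).indicator hB)) _),
            intervalIntegral.integral_const, intervalIntegral.integral_const_mul (m + Q * N'), hI,
            smul_eq_mul, mul_comm (t - s)]
        have hvolr : volume.real (B ∩ Ioc s t) ≤ ε' * h := by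
          refine ENNReal.toReal_le_of_le_ofReal (by positivity) ((measure_mono ?_).trans hvol)
          exact fun r hr => ⟨⟨hsT.1.trans hr.2.1.le, hr.2.2.trans htT.2⟩, hr.1⟩
        rw [hdiff]
        refine le_trans ?_ hlb
        rw [hval]
        have e1 : m * (κ * h / 3) ≤ m * (t - s) :=
          mul_le_mul_of_nonneg_left (by linarith) hm0
        have e2 : (m + Q * N') * volume.real (B ∩ Ioc s t) ≤ (m + Q * N') * (ε' * h) :=
          mul_le_mul_of_nonneg_left hvolr (by positivity)
        have e3 : (m + Q * N') * (ε' * h) = (c * κ + Q) * ε' * (h * N') := by rw [hm]; ring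
        have e4 : (c * κ + Q) * ε' * (h * N') ≤ c * κ ^ 2 / 6 * (h * N') :=
          mul_le_mul_of_nonneg_right hε2 (by positivity)
        have e5 : m * (κ * h / 3) = c * κ ^ 2 / 3 * (h * N') := by rw [hm]; ring
        rw [hμ]
        linarith
      -- Either `ω x₀` is quite negative on the whole left third, or it exceeds `-μ h N'` somewhere
      -- there; then the gain `2 μ h N'` over the middle third makes it at least `μ h N'` on the
      -- whole right third.
      by_cases hleft : ∀ s ∈ Icc α (α + (β - α) / 3), ω * x 0 s ≤ -(μ * (h * N'))
      · refine ⟨α, α + (β - α) / 3, -ω, hα, by linarith, ?_, ?_, fun s hs => hN.trans ?_⟩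
        · nlinarith
        · rcases hω1 with h1 | h1 <;> simp [h1]
        · linarith [hleft s hs]
      · push Not at hleft
        obtain ⟨s, hs, hs'⟩ := hleft
        refine ⟨β - (β - α) / 3, β, ω, by linarith, hβ, ?_, hω1, fun t ht => hN.trans ?_⟩
        · nlinarith
        · have := hinc s ⟨hs.1, by linarith [hs.2]⟩ t ⟨by linarith [ht.1], ht.2⟩
            (by linarith [hs.2, ht.1])
          linarith

/-- The integrated form of `exists_abs_zero_lower_bound`. -/
theorem exists_integral_sq_lower_bound {c M : ℝ} (hc : 0 < c) (hM : 1 ≤ M) (p : ℕ) :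
    ∃ κ > 0, ∃ ε > 0, ∀ (t₀ h : ℝ) (b : Fin p → ℝ → ℝ) (x : Fin (p + 1) → ℝ → ℝ) (σ : Fin p → ℝ)
      (B : Set ℝ), 0 < h → SolvesChain t₀ (t₀ + h) b (fun _ _ => 0) x →
      BoundedCoeff t₀ (t₀ + h) M b → MeasurableSet B →
      volume (Icc t₀ (t₀ + h) ∩ B) ≤ ENNReal.ofReal (ε * h) → (∀ i, σ i = 1 ∨ σ i = -1) →
      (∀ i, ∀ᵐ s ∂(volume.restrict (Icc t₀ (t₀ + h))), s ∉ B → c ≤ σ i * b i s) →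
      κ * h * (∑ j : Fin (p + 1), h ^ (j : ℕ) * |x j t₀|) ^ 2 ≤ ∫ s in t₀..(t₀ + h), x 0 s ^ 2 := by
  obtain ⟨κ, hκ, ε, hε, H⟩ := exists_abs_zero_lower_bound hc hM p
  -- One factor `κ` comes from the length of the subinterval, two from the square of the lower
  -- bound.
  refine ⟨κ ^ 3, by positivity, ε, hε, fun t₀ h b x σ B hh hx hb hB hvol hσ hlow => ?_⟩
  obtain ⟨α, β, τ, hα, hβ, hαβ, hτ, hx1⟩ := H t₀ h b x σ B hh hx hb hB hvol hσ hlow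
  set N := ∑ j : Fin (p + 1), h ^ (j : ℕ) * |x j t₀| with hN
  have hN0 : 0 ≤ N := by positivity
  have hαβ' : α < β := by nlinarith
  have hcont : ContinuousOn (fun s => x 0 s ^ 2) (Icc t₀ (t₀ + h)) := (hx.cont 0).pow 2
  have hint : IntervalIntegrable (fun s => x 0 s ^ 2) volume t₀ (t₀ + h) :=
    ContinuousOn.intervalIntegrable (by rwa [uIcc_of_le (by linarith)])
  have h1 : ∫ s in α..β, x 0 s ^ 2 ≤ ∫ s in t₀..(t₀ + h), x 0 s ^ 2 := by
    refine intervalIntegral.integral_mono_interval hα hαβ'.le hβ ?_ hint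
    exact Eventually.of_forall fun s => sq_nonneg _
  refine le_trans ?_ h1
  have h2 : ∫ _ in α..β, (κ * N) ^ 2 ≤ ∫ s in α..β, x 0 s ^ 2 := by
    refine intervalIntegral.integral_mono_on hαβ'.le intervalIntegrable_const
      (hint.mono_set ?_) fun s hs => ?_
    · rw [uIcc_of_le hαβ'.le, uIcc_of_le (by linarith)]; exact Icc_subset_Icc hα hβ
    · have := hx1 s hs
      have h3 : x 0 s ^ 2 = (τ * x 0 s) ^ 2 := by rcases hτ with h | h <;> rw [h] <;> ring
      rw [h3]
      exact pow_le_pow_left₀ (by positivity) this 2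
  refine le_trans ?_ h2
  rw [intervalIntegral.integral_const, smul_eq_mul]
  calc κ ^ 3 * h * N ^ 2 = (κ * h) * (κ * N) ^ 2 := by ring
    _ ≤ _ := mul_le_mul_of_nonneg_right hαβ (sq_nonneg _)

/-! ### The fundamental matrix and variation of constants -/

theorem continuousOn_primitive_of_intervalIntegrable {f : ℝ → ℝ} {t₀ T : ℝ} (hT : t₀ ≤ T)
    (hf : IntervalIntegrable f volume t₀ T) :
    ContinuousOn (fun t => ∫ s in t₀..t, f s) (Icc t₀ T) := by
  have := intervalIntegral.continuousOn_primitive_interval' hf left_mem_uIcc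
  rwa [uIcc_of_le hT] at this

theorem intervalIntegrable_of_mem_Icc {f : ℝ → ℝ} {t₀ T t : ℝ} (ht : t ∈ Icc t₀ T)
    (hf : IntervalIntegrable f volume t₀ T) : IntervalIntegrable f volume t₀ t := by
  refine hf.mono_set ?_
  rw [uIcc_of_le ht.1, uIcc_of_le (ht.1.trans ht.2)]
  exact Icc_subset_Icc_right ht.2

/-- Homogeneous chains are solvable for all initial values. -/
theorem exists_solvesChain {t₀ T M : ℝ} (hT : t₀ ≤ T) : ∀ {p : ℕ} {b : Fin p → ℝ → ℝ},
    BoundedCoeff t₀ T M b → ∀ v : Fin (p + 1) → ℝ,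
    ∃ x, SolvesChain t₀ T b (fun _ _ => 0) x ∧ ∀ i, x i t₀ = v i := by
  intro p
  induction p with
  | zero =>
    intro b _ v
    exact ⟨fun i _ => v i, ⟨fun i => continuousOn_const, fun i => i.elim0, fun t _ => by simp⟩,
      fun i => rfl⟩
  | succ p ih =>
    intro b hb v
    obtain ⟨x, hx, hx0⟩ := ih hb.tail (fun i => v i.succ)
    have hint := hb.intervalIntegrable_mul 0 (hx.cont 0) (left_mem_Icc.2 hT) (right_mem_Icc.2 hT)
    refine ⟨Fin.cons (fun t => v 0 + ∫ s in t₀..t, b 0 s * x 0 s) x, ⟨fun i => ?_, fun i => ?_, ?_⟩,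
      fun i => ?_⟩
    · refine Fin.cases ?_ (fun i => hx.cont i) i
      exact continuousOn_const.add (continuousOn_primitive_of_intervalIntegrable hT hint)
    · refine Fin.cases ?_ (fun i => ?_) i
      · intro t _
        simp
      · intro t ht
        have := hx.step i t ht
        rw [← Fin.succ_castSucc]
        simpa using this
    · intro t ht
      have := hx.last t ht
      rw [← Fin.succ_last]
      simpa using this
    · refine Fin.cases ?_ (fun i => ?_) i
      · simp
      · simpa using hx0 i

/-- The columns of `Φ` solve the homogeneous chain and `Φ(t₀) = 1`. -/
structure FundamentalMatrix {p : ℕ} (t₀ T : ℝ) (b : Fin p → ℝ → ℝ)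
    (Φ : ℝ → Matrix (Fin (p + 1)) (Fin (p + 1)) ℝ) : Prop where
  col : ∀ j, SolvesChain t₀ T b (fun _ _ => 0) (fun i t => Φ t i j)
  init : Φ t₀ = 1

theorem exists_fundamentalMatrix {t₀ T M : ℝ} (hT : t₀ ≤ T) {p : ℕ} {b : Fin p → ℝ → ℝ}
    (hb : BoundedCoeff t₀ T M b) : ∃ Φ, FundamentalMatrix t₀ T b Φ := by
  choose x hx hx0 using fun j : Fin (p + 1) =>
    exists_solvesChain hT hb (fun i => (1 : Matrix (Fin (p + 1)) (Fin (p + 1)) ℝ) i j)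
  exact ⟨fun t => Matrix.of fun i j => x j i t, hx, by ext i j; exact hx0 j i⟩

namespace FundamentalMatrix

variable {p : ℕ} {t₀ T M : ℝ} {b : Fin p → ℝ → ℝ}
  {Φ : ℝ → Matrix (Fin (p + 1)) (Fin (p + 1)) ℝ}

theorem mono (hΦ : FundamentalMatrix t₀ T b Φ) {T' : ℝ} (h : T' ≤ T) :
    FundamentalMatrix t₀ T' b Φ :=
  ⟨fun j => (hΦ.col j).mono h, hΦ.init⟩

theorem continuousOn_entry (hΦ : FundamentalMatrix t₀ T b Φ) (i j) :
    ContinuousOn (fun t => Φ t i j) (Icc t₀ T) :=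
  (hΦ.col j).cont i

theorem continuousOn (hΦ : FundamentalMatrix t₀ T b Φ) : ContinuousOn Φ (Icc t₀ T) :=
  continuousOn_pi.2 fun i => continuousOn_pi.2 fun j => hΦ.continuousOn_entry i j

/-- The fundamental matrix is upper triangular with unit diagonal. -/
theorem upperTriangular (hΦ : FundamentalMatrix t₀ T b Φ) (i : Fin (p + 1)) :
    ∀ t ∈ Icc t₀ T, (∀ j < i, Φ t i j = 0) ∧ Φ t i i = 1 := by
  induction i using Fin.reverseInduction with
  | last =>
    intro t ht
    have h : ∀ j, Φ t (Fin.last p) j = (1 : Matrix (Fin (p + 1)) (Fin (p + 1)) ℝ) (Fin.last p) j := by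
      intro j
      have := (hΦ.col j).last t ht
      simpa [hΦ.init] using this
    exact ⟨fun j hj => by rw [h, Matrix.one_apply_ne hj.ne'], by rw [h, Matrix.one_apply_eq]⟩
  | cast i ih =>
    intro t ht
    have h : ∀ j ≤ i.castSucc, Φ t i.castSucc j =
        (1 : Matrix (Fin (p + 1)) (Fin (p + 1)) ℝ) i.castSucc j := by
      intro j hj
      have h1 := (hΦ.col j).step i t ht
      simp only [hΦ.init, add_zero] at h1
      have h2 : ∫ s in t₀..t, b i s * Φ s i.succ j = 0 := by
        refine intervalIntegral.integral_zero_ae (Eventually.of_forall fun s hs => ?_)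
        rw [uIoc_of_le ht.1] at hs
        rw [(ih s ⟨hs.1.le, hs.2.trans ht.2⟩).1 j (hj.trans_lt i.castSucc_lt_succ), mul_zero]
      rw [h1, h2, add_zero]
    exact ⟨fun j hj => by rw [h j hj.le, Matrix.one_apply_ne hj.ne'],
      by rw [h _ le_rfl, Matrix.one_apply_eq]⟩

theorem det_eq_one (hΦ : FundamentalMatrix t₀ T b Φ) {t : ℝ} (ht : t ∈ Icc t₀ T) :
    (Φ t).det = 1 := by
  rw [Matrix.det_of_isUpperTriangular fun i j hij => (hΦ.upperTriangular i t ht).1 j hij]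
  exact Finset.prod_eq_one fun i _ => (hΦ.upperTriangular i t ht).2

theorem mul_inv (hΦ : FundamentalMatrix t₀ T b Φ) {t : ℝ} (ht : t ∈ Icc t₀ T) :
    Φ t * (Φ t)⁻¹ = 1 :=
  Matrix.mul_nonsing_inv _ (by rw [hΦ.det_eq_one ht]; exact isUnit_one)

theorem continuousOn_inv (hΦ : FundamentalMatrix t₀ T b Φ) :
    ContinuousOn (fun t => (Φ t)⁻¹) (Icc t₀ T) := by
  have h : ContinuousOn (fun t => (Φ t).adjugate) (Icc t₀ T) :=
    (continuous_id.matrix_adjugate).comp_continuousOn hΦ.continuousOn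
  refine h.congr fun t ht => ?_
  simp [Matrix.inv_def, hΦ.det_eq_one ht]

theorem intervalIntegrable_inv_mulVec (hΦ : FundamentalMatrix t₀ T b Φ) (hT : t₀ ≤ T)
    {g : Fin (p + 1) → ℝ → ℝ} (hg : ∀ i, IntervalIntegrable (g i) volume t₀ T) (k) :
    IntervalIntegrable (fun s => ((Φ s)⁻¹ *ᵥ fun j => g j s) k) volume t₀ T := by
  simp only [Matrix.mulVec, dotProduct]
  have : ∀ j, IntervalIntegrable (fun s => (Φ s)⁻¹ k j * g j s) volume t₀ T := fun j =>
    (hg j).continuousOn_mul (by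
      rw [uIcc_of_le hT]
      exact continuousOn_pi.1 (continuousOn_pi.1 hΦ.continuousOn_inv k) j)
  have h := IntervalIntegrable.sum Finset.univ (fun j _ => this j)
  convert! h using 1
  ext s
  simp

/-- Variation of constants. -/
theorem solvesChain_variation (hΦ : FundamentalMatrix t₀ T b Φ) (hb : BoundedCoeff t₀ T M b)
    (hT : t₀ ≤ T) {g : Fin (p + 1) → ℝ → ℝ} (hg : ∀ i, IntervalIntegrable (g i) volume t₀ T)
    (v : Fin (p + 1) → ℝ) :
    SolvesChain t₀ T b g
      (fun i t => ∑ k, Φ t i k * (v k + ∫ s in t₀..t, ((Φ s)⁻¹ *ᵥ fun j => g j s) k)) := by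
  set w : Fin (p + 1) → ℝ → ℝ := fun k s => ((Φ s)⁻¹ *ᵥ fun j => g j s) k with hw
  have hwi : ∀ k, IntervalIntegrable (w k) volume t₀ T := hΦ.intervalIntegrable_inv_mulVec hT hg
  set c : Fin (p + 1) → ℝ → ℝ := fun k t => v k + ∫ s in t₀..t, w k s with hc
  have hcc : ∀ k, ContinuousOn (c k) (Icc t₀ T) := fun k =>
    continuousOn_const.add (continuousOn_primitive_of_intervalIntegrable hT (hwi k))
  have hξ0 : ∀ i, ∑ k, Φ t₀ i k * c k t₀ = v i := by
    intro i
    simp [hc, hΦ.init, Matrix.one_apply]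
  -- The product rule applied to `Φ_{ik} c_k`: the terms with the derivative of `c` sum to `(Φ Φ⁻¹
  -- g)_i = g_i`. The derivative `f` of the row is left free so that the last row, where it is zero,
  -- is covered too.
  have row : ∀ i (f : Fin (p + 1) → ℝ → ℝ), (∀ k, IntervalIntegrable (f k) volume t₀ T) →
      (∀ k, ∀ t ∈ Icc t₀ T, Φ t i k = Φ t₀ i k + ∫ s in t₀..t, f k s) → ∀ t ∈ Icc t₀ T,
      ∑ k, Φ t i k * c k t = v i + ∫ s in t₀..t, (∑ k, f k s * c k s + g i s) := by
    intro i f hf hΦf t ht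
    have h1 : ∀ k, Φ t i k * c k t =
        Φ t₀ i k * v k + ∫ s in t₀..t, (f k s * c k s + Φ s i k * w k s) := fun k =>
      mul_eq_add_integral_of_primitive hT (hf k) (hwi k) (hΦf k) (fun t _ => rfl) ht
    have hint : ∀ k, IntervalIntegrable (fun s => f k s * c k s + Φ s i k * w k s) volume t₀ t :=
      fun k => intervalIntegrable_of_mem_Icc ht
        (((hf k).mul_continuousOn (by rw [uIcc_of_le hT]; exact hcc k)).add
          ((hwi k).continuousOn_mul (by rw [uIcc_of_le hT]; exact hΦ.continuousOn_entry i k)))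
    rw [Finset.sum_congr rfl fun k _ => h1 k, Finset.sum_add_distrib,
      ← intervalIntegral.integral_finsetSum fun k _ => hint k]
    congr 1
    · simp [hΦ.init, Matrix.one_apply]
    · refine intervalIntegral.integral_congr fun s hs => ?_
      rw [uIcc_of_le ht.1] at hs
      have hs' : s ∈ Icc t₀ T := ⟨hs.1, hs.2.trans ht.2⟩
      simp only [Finset.sum_add_distrib, add_right_inj]
      have h2 : Φ s *ᵥ ((Φ s)⁻¹ *ᵥ fun j => g j s) = fun j => g j s := by
        rw [Matrix.mulVec_mulVec, hΦ.mul_inv hs', Matrix.one_mulVec]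
      exact congrFun h2 i
  refine ⟨fun i => ?_, fun i t ht => ?_, fun t ht => ?_⟩
  · exact continuousOn_finsetSum _ fun k _ => (hΦ.continuousOn_entry i k).mul (hcc k)
  · have h := row i.castSucc (fun k s => b i s * Φ s i.succ k)
      (fun k => hb.intervalIntegrable_mul i (hΦ.continuousOn_entry _ _) (left_mem_Icc.2 hT)
        (right_mem_Icc.2 hT))
      (fun k t ht => by simpa using (hΦ.col k).step i t ht) t ht
    rw [h, hξ0]
    congr 1
    refine intervalIntegral.integral_congr fun s _ => ?_
    simp only [Finset.mul_sum, mul_assoc]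
    rfl
  · have h := row (Fin.last p) (fun k s => 0) (fun k => intervalIntegrable_const)
      (fun k t ht => by simpa using (hΦ.col k).last t ht) t ht
    rw [h, hξ0]
    simp

theorem solvesChain_mulVec (hΦ : FundamentalMatrix t₀ T b Φ) (hb : BoundedCoeff t₀ T M b)
    (hT : t₀ ≤ T) (v : Fin (p + 1) → ℝ) :
    SolvesChain t₀ T b (fun _ _ => 0) (fun i t => (Φ t *ᵥ v) i) := by
  have h := hΦ.solvesChain_variation hb hT (g := fun _ _ => 0) (fun _ => intervalIntegrable_const) v
  have h0 : (fun _ : Fin (p + 1) => (0 : ℝ)) = 0 := rfl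
  simp only [h0, Matrix.mulVec_zero, Pi.zero_apply, intervalIntegral.integral_zero, add_zero] at h
  exact h

end FundamentalMatrix

/-! ### The Gramian and the least squares equation -/

/-- The observability Gramian of the first component. -/
noncomputable def gram {p : ℕ} (t₀ : ℝ) (Φ : ℝ → Matrix (Fin (p + 1)) (Fin (p + 1)) ℝ) (t : ℝ) :
    Matrix (Fin (p + 1)) (Fin (p + 1)) ℝ :=
  Matrix.of fun i j => ∫ s in t₀..t, Φ s 0 i * Φ s 0 j

/-- Quantitative observability of the homogeneous chain on `[t₀,t₀+h]`. -/
def Coercive {p : ℕ} (κ t₀ h : ℝ) (b : Fin p → ℝ → ℝ) : Prop :=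
  ∀ x, SolvesChain t₀ (t₀ + h) b (fun _ _ => 0) x →
    κ * h * (∑ j : Fin (p + 1), h ^ (j : ℕ) * |x j t₀|) ^ 2 ≤ ∫ s in t₀..(t₀ + h), x 0 s ^ 2

section Gram

variable {p : ℕ} {t₀ T M κ h : ℝ} {b : Fin p → ℝ → ℝ}
  {Φ : ℝ → Matrix (Fin (p + 1)) (Fin (p + 1)) ℝ}

theorem gram_mulVec (hΦ : ∀ j, ContinuousOn (fun t => Φ t 0 j) (Icc t₀ T)) {t : ℝ}
    (ht : t ∈ Icc t₀ T) (v : Fin (p + 1) → ℝ) (i) :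
    (gram t₀ Φ t *ᵥ v) i = ∫ s in t₀..t, Φ s 0 i * (Φ s *ᵥ v) 0 := by
  have hint : ∀ j, IntervalIntegrable (fun s => Φ s 0 i * Φ s 0 j * v j) volume t₀ t := fun j =>
    ContinuousOn.intervalIntegrable (by
      rw [uIcc_of_le ht.1]
      exact (((hΦ i).mul (hΦ j)).mul continuousOn_const).mono (Icc_subset_Icc_right ht.2))
  simp only [Matrix.mulVec, dotProduct, gram, Matrix.of_apply, ← intervalIntegral.integral_mul_const]
  rw [← intervalIntegral.integral_finsetSum fun j _ => hint j]
  simp only [Finset.mul_sum, mul_assoc]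

/-- With `η` the first component of `Φ v` this yields the quadratic form of the Gramian; with
general `η` it pairs the least squares equation with its solution. -/
theorem dotProduct_integral_row (hΦ : ∀ j, ContinuousOn (fun t => Φ t 0 j) (Icc t₀ T)) {t : ℝ}
    (ht : t ∈ Icc t₀ T) (v : Fin (p + 1) → ℝ) {η : ℝ → ℝ} (hη : IntervalIntegrable η volume t₀ t) :
    v ⬝ᵥ (fun i => ∫ s in t₀..t, Φ s 0 i * η s) = ∫ s in t₀..t, (Φ s *ᵥ v) 0 * η s := by
  have hint : ∀ j, IntervalIntegrable (fun s => v j * (Φ s 0 j * η s)) volume t₀ t := fun j =>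
    (hη.continuousOn_mul (by
      rw [uIcc_of_le ht.1]; exact (hΦ j).mono (Icc_subset_Icc_right ht.2))).const_mul _
  simp only [Matrix.mulVec, dotProduct, ← intervalIntegral.integral_const_mul]
  rw [← intervalIntegral.integral_finsetSum fun j _ => hint j]
  refine intervalIntegral.integral_congr fun s _ => ?_
  simp only [Finset.sum_mul]
  exact Finset.sum_congr rfl fun j _ => by ring

theorem continuousOn_mulVec_zero (hΦ : ∀ j, ContinuousOn (fun t => Φ t 0 j) (Icc t₀ T))
    (v : Fin (p + 1) → ℝ) : ContinuousOn (fun t => (Φ t *ᵥ v) 0) (Icc t₀ T) := by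
  simp only [Matrix.mulVec, dotProduct]
  exact continuousOn_finsetSum _ fun j _ => (hΦ j).mul continuousOn_const

theorem dotProduct_gram_mulVec (hΦ : ∀ j, ContinuousOn (fun t => Φ t 0 j) (Icc t₀ T)) {t : ℝ}
    (ht : t ∈ Icc t₀ T) (v : Fin (p + 1) → ℝ) :
    v ⬝ᵥ (gram t₀ Φ t *ᵥ v) = ∫ s in t₀..t, (Φ s *ᵥ v) 0 ^ 2 := by
  have h : gram t₀ Φ t *ᵥ v = fun i => ∫ s in t₀..t, Φ s 0 i * (Φ s *ᵥ v) 0 :=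
    funext fun i => gram_mulVec hΦ ht v i
  rw [h, dotProduct_integral_row hΦ ht v]
  · simp only [sq]
  · refine ContinuousOn.intervalIntegrable ?_
    rw [uIcc_of_le ht.1]
    exact (continuousOn_mulVec_zero hΦ v).mono (Icc_subset_Icc_right ht.2)

/-- The quadratic form at `v` is the integral of the squared first component of `Φ v`. Coercivity
makes it positive at `t₀ + h`, and it does not decrease in `t`. -/
theorem gram_posDef (hΦ : FundamentalMatrix t₀ T b Φ) (hb : BoundedCoeff t₀ T M b) (hκ : 0 < κ)
    (hh : 0 < h) (hco : Coercive κ t₀ h b) {t : ℝ} (ht : t ∈ Icc (t₀ + h) T) :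
    (gram t₀ Φ t).PosDef := by
  have hc := fun j => hΦ.continuousOn_entry 0 j
  have htT : t ∈ Icc t₀ T := ⟨by linarith [ht.1], ht.2⟩
  refine Matrix.PosDef.of_dotProduct_mulVec_pos ?_ fun v hv => ?_
  · ext i j
    simp [gram, mul_comm]
  · rw [star_trivial, dotProduct_gram_mulVec hc htT v]
    have hle : t₀ + h ≤ T := ht.1.trans ht.2
    have h1 := hco _ ((hΦ.mono hle).solvesChain_mulVec (hb.mono hle) (by linarith) v)
    have h2 : ∫ s in t₀..(t₀ + h), (Φ s *ᵥ v) 0 ^ 2 ≤ ∫ s in t₀..t, (Φ s *ᵥ v) 0 ^ 2 := by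
      refine intervalIntegral.integral_mono_interval le_rfl (by linarith) ht.1
        (Eventually.of_forall fun s => sq_nonneg _) (ContinuousOn.intervalIntegrable ?_)
      rw [uIcc_of_le htT.1]
      exact ((continuousOn_mulVec_zero hc v).pow 2).mono (Icc_subset_Icc_right ht.2)
    refine lt_of_lt_of_le ?_ (h1.trans h2)
    rw [hΦ.init, Matrix.one_mulVec]
    obtain ⟨j, hj⟩ := Function.ne_iff.1 hv
    have h3 : 0 < ∑ j : Fin (p + 1), h ^ (j : ℕ) * |v j| :=
      Finset.sum_pos' (fun _ _ => by positivity)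
        ⟨j, Finset.mem_univ _, mul_pos (by positivity) (abs_pos.2 hj)⟩
    positivity

/-- The least squares solution depends on the data in a bounded way, in weighted norm. -/
theorem gram_solution_bound (hΦ : FundamentalMatrix t₀ (t₀ + h) b Φ)
    (hb : BoundedCoeff t₀ (t₀ + h) M b) (hM : 1 ≤ M)
    (hh : 0 < h) (hco : Coercive κ t₀ h b) {η : ℝ → ℝ} {E : ℝ}
    (hη : ContinuousOn η (Icc t₀ (t₀ + h))) (hE : ∀ s ∈ Icc t₀ (t₀ + h), |η s| ≤ E)
    {v : Fin (p + 1) → ℝ}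
    (hv : gram t₀ Φ (t₀ + h) *ᵥ v = fun i => ∫ s in t₀..(t₀ + h), Φ s 0 i * η s) :
    κ * ∑ j : Fin (p + 1), h ^ (j : ℕ) * |v j| ≤ M ^ p * E := by
  have hc := fun j => hΦ.continuousOn_entry 0 j
  have hle : t₀ ≤ t₀ + h := by linarith
  have htT : t₀ + h ∈ Icc t₀ (t₀ + h) := right_mem_Icc.2 hle
  have hE0 : 0 ≤ E := (abs_nonneg _).trans (hE _ htT)
  have hηi : IntervalIntegrable η volume t₀ (t₀ + h) :=
    ContinuousOn.intervalIntegrable (by rwa [uIcc_of_le hle])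
  have hx := hΦ.solvesChain_mulVec hb hle v
  have h1 := hco _ hx
  rw [← dotProduct_gram_mulVec hc htT v, hv, dotProduct_integral_row hc htT v hηi] at h1
  rw [hΦ.init, Matrix.one_mulVec] at h1
  set N := ∑ j : Fin (p + 1), h ^ (j : ℕ) * |v j| with hN
  have hN0 : 0 ≤ N := by positivity
  have hup : ∀ s ∈ Icc t₀ (t₀ + h), |(Φ s *ᵥ v) 0| ≤ M ^ p * N := by
    intro s hs
    have := hx.abs_zero_le (G := 0) hle hM le_rfl hb (fun _ _ => rfl) (by simp) s hs
    simpa [hΦ.init] using this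
  have h2 : ∫ s in t₀..(t₀ + h), (Φ s *ᵥ v) 0 * η s ≤ M ^ p * N * E * (t₀ + h - t₀) := by
    refine (le_abs_self _).trans (abs_integral_le_of_ae_Icc htT (by positivity) ?_)
    filter_upwards [ae_restrict_mem measurableSet_Icc] with s hs
    rw [abs_mul]
    exact mul_le_mul (hup s hs) (hE s hs) (abs_nonneg _) (by positivity)
  rw [add_sub_cancel_left] at h2
  -- Pairing the equation with `v` gives `κ h N² ≤ h M^p N E`; the claim follows on cancelling `h
  -- N`, with `N = 0` treated apart.
  have h3 : h * (N * (κ * N)) ≤ h * (N * (M ^ p * E)) := by linarith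
  have h4 := le_of_mul_le_mul_left h3 hh
  rcases hN0.eq_or_lt with h5 | h5
  · rw [← h5, mul_zero]; positivity
  · exact le_of_mul_le_mul_left h4 h5

end Gram

/-! ### The triangular system in coordinates -/

theorem Matrix.act_apply {p q : ℕ} (M : Matrix (Fin p) (Fin q) ℝ) (v : Vec q) (i : Fin p) :
    M.act v i = (M *ᵥ v.ofLp) i := rfl

theorem norm_le_sum_abs {n : ℕ} (v : Vec n) : ‖v‖ ≤ ∑ i, |v i| := by
  rw [EuclideanSpace.norm_eq]
  refine Real.sqrt_le_left (Finset.sum_nonneg fun _ _ => abs_nonneg _) |>.2 ?_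
  simp only [Real.norm_eq_abs]
  exact Finset.sum_sq_le_sq_sum_of_nonneg fun _ _ => abs_nonneg _

theorem abs_apply_le_norm {n : ℕ} (v : Vec n) (i : Fin n) : |v i| ≤ ‖v‖ :=
  PiLp.norm_apply_le v i

theorem intervalIntegral_apply {n : ℕ} {f : ℝ → Vec n} {a b : ℝ}
    (hf : ∀ i, IntervalIntegrable (fun s => f s i) volume a b) (i : Fin n) :
    (∫ s in a..b, f s) i = ∫ s in a..b, f s i := by
  simp only [intervalIntegral, PiLp.sub_apply]
  rw [eval_integral_piLp fun i => (hf i).1, eval_integral_piLp fun i => (hf i).2]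

theorem IntervalIntegrable.vec_apply {n : ℕ} {f : ℝ → Vec n} {a b : ℝ}
    (hf : IntervalIntegrable f volume a b) (i : Fin n) :
    IntervalIntegrable (fun s => f s i) volume a b :=
  ⟨Integrable.eval_piLp hf.1 i, Integrable.eval_piLp hf.2 i⟩

namespace TriangularSystem

variable {p m : ℕ} (S : TriangularSystem p m)

/-- The superdiagonal coefficients along an output and an input. -/
def coeff (y : ℝ → Vec 1) (u : ℝ → Vec m) (i : Fin p) (s : ℝ) : ℝ := S.a i s (y s 0) (u s)

/-- The nonlinear term along an output, a state function and an input. -/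
def drift (y : ℝ → Vec 1) (u : ℝ → Vec m) (d : ℝ → Vec (p + 1)) (s : ℝ) : Vec (p + 1) :=
  S.toControlSystem.f s (y s) (d s) (u s)

theorem drift_castSucc (y : ℝ → Vec 1) (u : ℝ → Vec m) (d : ℝ → Vec (p + 1)) (s : ℝ) (i : Fin p) :
    S.drift y u d s i.castSucc = S.f i s (y s 0) (u s) := by
  simp [drift, toControlSystem]

theorem drift_last (y : ℝ → Vec 1) (u : ℝ → Vec m) (d : ℝ → Vec (p + 1)) (s : ℝ) :
    S.drift y u d s (Fin.last p) =
      S.fLast s (WithLp.toLp 2 (Function.update (d s).ofLp 0 (y s 0))) (u s) := by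
  simp [drift, toControlSystem]

theorem A_mulVec_castSucc (t : ℝ) (y : Vec 1) (u : Vec m) (v : Fin (p + 1) → ℝ) (i : Fin p) :
    (S.toControlSystem.A t y u *ᵥ v) i.castSucc = S.a i t (y 0) u * v i.succ := by
  simp [toControlSystem, Matrix.mulVec, dotProduct]

theorem A_mulVec_last (t : ℝ) (y : Vec 1) (u : Vec m) (v : Fin (p + 1) → ℝ) :
    (S.toControlSystem.A t y u *ᵥ v) (Fin.last p) = 0 := by
  simp [toControlSystem, Matrix.mulVec, dotProduct]

theorem A_mul_castSucc (t : ℝ) (y : Vec 1) (u : Vec m) (N : Matrix (Fin (p + 1)) (Fin (p + 1)) ℝ)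
    (i : Fin p) (j) : (S.toControlSystem.A t y u * N) i.castSucc j = S.a i t (y 0) u * N i.succ j :=
  S.A_mulVec_castSucc t y u (fun k => N k j) i

theorem A_mul_last (t : ℝ) (y : Vec 1) (u : Vec m) (N : Matrix (Fin (p + 1)) (Fin (p + 1)) ℝ) (j) :
    (S.toControlSystem.A t y u * N) (Fin.last p) j = 0 :=
  S.A_mulVec_last t y u (fun k => N k j)

theorem C_act (t : ℝ) (u : Vec m) (x : Vec (p + 1)) (i) :
    (S.toControlSystem.C t u).act x i = x 0 := by
  simp [toControlSystem, Matrix.act_apply, Matrix.mulVec, dotProduct]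

theorem transpose_mul_transpose_C (t : ℝ) (u : Vec m) (N : Matrix (Fin (p + 1)) (Fin (p + 1)) ℝ) (i j) :
    (Nᵀ * (S.toControlSystem.C t u)ᵀ) i j = N 0 i := by
  simp [toControlSystem, Matrix.mul_apply]

theorem C_mul (t : ℝ) (u : Vec m) (N : Matrix (Fin (p + 1)) (Fin (p + 1)) ℝ) (i j) :
    (S.toControlSystem.C t u * N) i j = N 0 j := by
  simp [toControlSystem, Matrix.mul_apply]

theorem transpose_mul_C_mul (t : ℝ) (u : Vec m) (N : Matrix (Fin (p + 1)) (Fin (p + 1)) ℝ) (i j) :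
    (Nᵀ * (S.toControlSystem.C t u)ᵀ * S.toControlSystem.C t u * N) i j = N 0 i * N 0 j := by
  rw [Matrix.mul_assoc, Matrix.mul_apply]
  simp [transpose_mul_transpose_C, C_mul]

theorem transpose_mul_C_mul_mulVec (t : ℝ) (u : Vec m)
    (N : Matrix (Fin (p + 1)) (Fin (p + 1)) ℝ) (v : Fin (p + 1) → ℝ) (i) :
    ((Nᵀ * (S.toControlSystem.C t u)ᵀ * S.toControlSystem.C t u * N) *ᵥ v) i =
      N 0 i * (N *ᵥ v) 0 := by
  simp only [Matrix.mulVec, dotProduct, transpose_mul_C_mul, Finset.mul_sum, mul_assoc]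

theorem Psi_eq_gram (t₀ : ℝ) (u : ℝ → Vec m) (Φ : ℝ → Matrix (Fin (p + 1)) (Fin (p + 1)) ℝ) (t : ℝ) :
    S.toControlSystem.Psi t₀ u Φ t = gram t₀ Φ t := by
  ext i j
  simp only [ControlSystem.Psi, gram, Matrix.of_apply, transpose_mul_C_mul]

section Fundamental

variable {t₀ τ M : ℝ} {y : ℝ → Vec 1} {u : ℝ → Vec m}
  {Φ : ℝ → Matrix (Fin (p + 1)) (Fin (p + 1)) ℝ}

theorem fundamentalMatrix_of_isFundamental (hτ : t₀ ≤ τ)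
    (h : S.toControlSystem.IsFundamental t₀ τ y u Φ) :
    FundamentalMatrix t₀ τ (S.coeff y u) Φ := by
  have hinit : Φ t₀ = 1 := by
    ext i j
    simpa using h.eq t₀ (left_mem_Icc.2 hτ) i j
  refine ⟨fun j => ⟨fun i => continuousOn_pi.1 (continuousOn_pi.1 h.continuousOn i) j,
    fun i t ht => ?_, fun t ht => ?_⟩, hinit⟩
  · have := h.eq t ht i.castSucc j
    simp only [A_mul_castSucc] at this
    simpa [hinit, coeff] using this
  · have := h.eq t ht (Fin.last p) j
    simp only [A_mul_last] at this
    simpa [hinit] using this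

theorem isFundamental_of_fundamentalMatrix (hτ : t₀ ≤ τ) (hb : BoundedCoeff t₀ τ M (S.coeff y u))
    (h : FundamentalMatrix t₀ τ (S.coeff y u) Φ) :
    S.toControlSystem.IsFundamental t₀ τ y u Φ := by
  refine ⟨h.continuousOn, fun i j => ?_, fun t ht i j => ?_⟩
  · refine Fin.lastCases ?_ (fun i => ?_) i
    · simp only [A_mul_last]
      exact intervalIntegrable_const
    · simp only [A_mul_castSucc]
      exact hb.intervalIntegrable_mul i (h.continuousOn_entry _ _) (left_mem_Icc.2 hτ)
        (right_mem_Icc.2 hτ)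
  · refine Fin.lastCases ?_ (fun i => ?_) i
    · have := (h.col j).last t ht
      simp only [A_mul_last]
      simpa [h.init] using this
    · have := (h.col j).step i t ht
      simp only [A_mul_castSucc]
      simpa [h.init, coeff] using this

end Fundamental

end TriangularSystem

/-- `∫_{t₀}^t Φ(t₀,s) g(s) ds`. -/
noncomputable def transported {n : ℕ} (t₀ : ℝ) (Φ : ℝ → Matrix (Fin n) (Fin n) ℝ) (g : ℝ → Vec n)
    (t : ℝ) (k : Fin n) : ℝ :=
  ∫ s in t₀..t, ((Φ s)⁻¹ *ᵥ (g s).ofLp) k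

section Transported

variable {p : ℕ} {t₀ T M : ℝ} {b : Fin p → ℝ → ℝ}
  {Φ : ℝ → Matrix (Fin (p + 1)) (Fin (p + 1)) ℝ} {g : ℝ → Vec (p + 1)}

theorem continuousOn_transported (hΦ : FundamentalMatrix t₀ T b Φ) (hT : t₀ ≤ T)
    (hg : ∀ i, IntervalIntegrable (fun s => g s i) volume t₀ T) (k) :
    ContinuousOn (fun t => transported t₀ Φ g t k) (Icc t₀ T) :=
  continuousOn_primitive_of_intervalIntegrable hT (hΦ.intervalIntegrable_inv_mulVec hT hg k)

theorem continuousOn_mulVec_transported (hΦ : FundamentalMatrix t₀ T b Φ) (hT : t₀ ≤ T)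
    (hg : ∀ i, IntervalIntegrable (fun s => g s i) volume t₀ T) (i) :
    ContinuousOn (fun t => (Φ t *ᵥ transported t₀ Φ g t) i) (Icc t₀ T) := by
  simp only [Matrix.mulVec, dotProduct]
  exact continuousOn_finsetSum _ fun k _ =>
    (hΦ.continuousOn_entry i k).mul (continuousOn_transported hΦ hT hg k)

theorem transported_sub (hΦ : FundamentalMatrix t₀ T b Φ) (hT : t₀ ≤ T) {g' : ℝ → Vec (p + 1)}
    (hg : ∀ i, IntervalIntegrable (fun s => g s i) volume t₀ T)
    (hg' : ∀ i, IntervalIntegrable (fun s => g' s i) volume t₀ T) {t : ℝ} (ht : t ∈ Icc t₀ T) :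
    transported t₀ Φ g t - transported t₀ Φ g' t = transported t₀ Φ (fun s => g s - g' s) t := by
  ext k
  simp only [transported, Pi.sub_apply, WithLp.ofLp_sub, Matrix.mulVec_sub]
  rw [intervalIntegral.integral_sub
    (intervalIntegrable_of_mem_Icc ht (hΦ.intervalIntegrable_inv_mulVec hT hg k))
    (intervalIntegrable_of_mem_Icc ht (hΦ.intervalIntegrable_inv_mulVec hT hg' k))]

theorem solvesChain_transported (hΦ : FundamentalMatrix t₀ T b Φ) (hb : BoundedCoeff t₀ T M b)
    (hT : t₀ ≤ T) (hg : ∀ i, IntervalIntegrable (fun s => g s i) volume t₀ T)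
    (v : Fin (p + 1) → ℝ) :
    SolvesChain t₀ T b (fun i s => g s i) (fun i t => (Φ t *ᵥ (v + transported t₀ Φ g t)) i) :=
  hΦ.solvesChain_variation hb hT hg v

theorem transported_self (v : Fin (p + 1)) : transported t₀ Φ g t₀ v = 0 := by
  simp [transported]

end Transported

namespace TriangularSystem

variable {p m : ℕ} (S : TriangularSystem p m)

section Coordinates

variable {t₀ T M : ℝ} {y : ℝ → Vec 1} {u : ℝ → Vec m} {b : Fin p → ℝ → ℝ}
  {Φ : ℝ → Matrix (Fin (p + 1)) (Fin (p + 1)) ℝ} {d : ℝ → Vec (p + 1)}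

theorem Xi_apply (hΦ : FundamentalMatrix t₀ T b Φ) (hT : t₀ ≤ T)
    (hg : ∀ i, IntervalIntegrable (fun s => S.drift y u d s i) volume t₀ T) (i) :
    S.toControlSystem.Xi t₀ y u Φ d T i =
      ∫ ρ in t₀..T, Φ ρ 0 i * (Φ ρ *ᵥ transported t₀ Φ (S.drift y u d) ρ) 0 := by
  have hEq : ∀ ρ ∈ Icc t₀ T, ∀ i, (((Φ ρ)ᵀ * (S.toControlSystem.C ρ (u ρ))ᵀ *
      S.toControlSystem.C ρ (u ρ) * Φ ρ).act (∫ s in t₀..ρ, ((Φ s)⁻¹).act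
        (S.toControlSystem.f s (y s) (d s) (u s)))) i =
      Φ ρ 0 i * (Φ ρ *ᵥ transported t₀ Φ (S.drift y u d) ρ) 0 := by
    intro ρ hρ i
    rw [Matrix.act_apply, transpose_mul_C_mul_mulVec]
    have : (∫ s in t₀..ρ, ((Φ s)⁻¹).act (S.toControlSystem.f s (y s) (d s) (u s))).ofLp =
        transported t₀ Φ (S.drift y u d) ρ := by
      ext k
      exact intervalIntegral_apply (fun k => intervalIntegrable_of_mem_Icc hρ
        (hΦ.intervalIntegrable_inv_mulVec hT hg k)) k
    rw [this]
  have hcont : ∀ i, ContinuousOn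
      (fun ρ => Φ ρ 0 i * (Φ ρ *ᵥ transported t₀ Φ (S.drift y u d) ρ) 0) (Icc t₀ T) := fun i =>
    (hΦ.continuousOn_entry 0 i).mul (continuousOn_mulVec_transported hΦ hT hg 0)
  rw [ControlSystem.Xi, intervalIntegral_apply]
  · refine intervalIntegral.integral_congr fun ρ hρ => ?_
    rw [uIcc_of_le hT] at hρ
    exact hEq ρ hρ i
  · intro i
    refine ContinuousOn.intervalIntegrable ?_
    rw [uIcc_of_le hT]
    exact (hcont i).congr fun ρ hρ => hEq ρ hρ i

theorem iterOp_apply (hΦ : FundamentalMatrix t₀ T b Φ) (hT : t₀ ≤ T)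
    (hg : ∀ i, IntervalIntegrable (fun s => S.drift y u d s i) volume t₀ T) {t : ℝ}
    (ht : t ∈ Icc t₀ T) (i) :
    S.toControlSystem.iterOp t₀ y u Φ T d t i =
      (Φ t *ᵥ ((gram t₀ Φ T)⁻¹ *ᵥ ((∫ ρ in t₀..T, ((Φ ρ)ᵀ *
        (S.toControlSystem.C ρ (u ρ))ᵀ).act (y ρ)) - S.toControlSystem.Xi t₀ y u Φ d T).ofLp
        + transported t₀ Φ (S.drift y u d) t)) i := by
  have hint : ∀ k, IntervalIntegrable (fun s => ((Φ s)⁻¹ *ᵥ (S.drift y u d s).ofLp) k)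
      volume t₀ t := fun k =>
    intervalIntegrable_of_mem_Icc ht (hΦ.intervalIntegrable_inv_mulVec hT hg k)
  have hexp : ∀ s i, ((Φ t * (Φ s)⁻¹).act (S.toControlSystem.f s (y s) (d s) (u s))) i =
      ∑ k, Φ t i k * ((Φ s)⁻¹ *ᵥ (S.drift y u d s).ofLp) k := by
    intro s i
    rw [Matrix.act_apply, ← Matrix.mulVec_mulVec]
    rfl
  rw [ControlSystem.iterOp, PiLp.add_apply, Matrix.mulVec_add, Pi.add_apply, Psi_eq_gram,
    Matrix.mulVec_mulVec]
  congr 1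
  rw [intervalIntegral_apply]
  · simp only [hexp]
    rw [intervalIntegral.integral_finsetSum fun k _ => (hint k).const_mul _]
    simp only [intervalIntegral.integral_const_mul]
    rfl
  · intro i
    simp only [hexp]
    have h := IntervalIntegrable.sum Finset.univ fun k _ => (hint k).const_mul (Φ t i k)
    convert! h using 1
    ext s
    simp

theorem continuousOn_iterOp (hΦ : FundamentalMatrix t₀ T b Φ) (hT : t₀ ≤ T)
    (hg : ∀ i, IntervalIntegrable (fun s => S.drift y u d s i) volume t₀ T) :
    ContinuousOn (S.toControlSystem.iterOp t₀ y u Φ T d) (Icc t₀ T) := by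
  have h : ∀ i, ContinuousOn (fun t => S.toControlSystem.iterOp t₀ y u Φ T d t i) (Icc t₀ T) := by
    intro i
    refine ContinuousOn.congr ?_ fun t ht => S.iterOp_apply hΦ hT hg ht i
    simp only [Matrix.mulVec, dotProduct, Pi.add_apply]
    exact continuousOn_finsetSum _ fun k _ => (hΦ.continuousOn_entry i k).mul
      (continuousOn_const.add (continuousOn_transported hΦ hT hg k))
  exact (PiLp.continuous_toLp 2 _).comp_continuousOn (continuousOn_pi.2 h)

/-- A solution of the system with output `y` solves the chain along `y`. -/
theorem solvesChain_of_isSolution {x₀ : Vec (p + 1)} {x : ℝ → Vec (p + 1)} (hT : t₀ ≤ T)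
    (hx : S.toControlSystem.IsSolution t₀ T u x₀ x)
    (hy : ∀ᵐ t ∂(volume.restrict (Icc t₀ T)), y t = (S.toControlSystem.C t (u t)).act (x t)) :
    SolvesChain t₀ T (S.coeff y u) (fun i s => S.drift y u x s i) (fun i t => x t i) ∧
      x t₀ = x₀ := by
  have h0 : x t₀ = x₀ := by simpa using hx.eq t₀ (left_mem_Icc.2 hT)
  have key : ∀ t ∈ Icc t₀ T, ∀ i, x t i = x t₀ i + ∫ s in t₀..t,
      ((S.toControlSystem.A s (y s) (u s) *ᵥ (x s).ofLp) i + S.drift y u x s i) := by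
    intro t ht i
    have h1 := congrArg (fun v : Vec (p + 1) => v i) (hx.eq t ht)
    simp only [PiLp.add_apply] at h1
    have hint : IntervalIntegrable (fun s => S.toControlSystem.rhs s (x s) (u s)) volume t₀ t := by
      refine hx.integrable.mono_set ?_
      rw [uIcc_of_le ht.1, uIcc_of_le hT]; exact Icc_subset_Icc_right ht.2
    rw [h1, h0, intervalIntegral_apply hint.vec_apply]
    congr 1
    refine intervalIntegral.integral_congr_ae ?_
    filter_upwards [(ae_restrict_iff' measurableSet_Icc).1 hy] with s hs hs'
    rw [uIoc_of_le ht.1] at hs'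
    rw [ControlSystem.rhs, ← hs ⟨hs'.1.le, hs'.2.trans ht.2⟩]
    rfl
  refine ⟨⟨fun i => ?_, fun i t ht => ?_, fun t ht => ?_⟩, h0⟩
  · exact (PiLp.continuous_apply 2 (fun _ => ℝ) i).comp_continuousOn hx.continuousOn
  · have := key t ht i.castSucc
    simp only [A_mulVec_castSucc] at this
    exact this
  · have := key t ht (Fin.last p)
    simp only [A_mulVec_last, zero_add] at this
    exact this

end Coordinates

/-! ### Contraction and fixed points along a tame output -/

/-- The regularity and quantitative observability of the system along an output `y` and an input
`u` on `[t₀,τ]`, on which the contraction argument rests. -/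
structure Tame (t₀ τ M κ h₀ : ℝ) (y : ℝ → Vec 1) (u : ℝ → Vec m) : Prop where
  lt : t₀ < τ
  one_le : 1 ≤ M
  coeff : BoundedCoeff t₀ τ M (S.coeff y u)
  κ_pos : 0 < κ
  h₀_pos : 0 < h₀
  coercive : ∀ h, 0 < h → h ≤ h₀ → t₀ + h ≤ τ → Coercive κ t₀ h (S.coeff y u)
  integrable : ∀ T ∈ Icc t₀ τ, ∀ d, ContinuousOn d (Icc t₀ T) →
    ∀ i, IntervalIntegrable (fun s => S.drift y u d s i) volume t₀ T
  lipschitz : ∀ R : ℝ, ∃ L, 0 ≤ L ∧ ∀ᵐ s ∂(volume.restrict (Icc t₀ τ)), ∀ v w : Vec (p + 1),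
    ‖v‖ ≤ R → ‖w‖ ≤ R →
    |S.toControlSystem.f s (y s) v (u s) (Fin.last p) -
      S.toControlSystem.f s (y s) w (u s) (Fin.last p)| ≤ L * ‖v - w‖

namespace Tame

variable {S} {t₀ τ M κ h₀ : ℝ} {y : ℝ → Vec 1} {u : ℝ → Vec m}
  {Φ : ℝ → Matrix (Fin (p + 1)) (Fin (p + 1)) ℝ}

theorem gram_posDef (H : S.Tame t₀ τ M κ h₀ y u) (hΦ : FundamentalMatrix t₀ τ (S.coeff y u) Φ)
    {t : ℝ} (ht : t ∈ Ioc t₀ τ) : (gram t₀ Φ t).PosDef := by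
  -- Coercivity is available only up to length `h₀`, but later times inherit positivity from an
  -- initial interval.
  have hm : 0 < min h₀ (t - t₀) := lt_min H.h₀_pos (sub_pos.2 ht.1)
  have hm' : t₀ + min h₀ (t - t₀) ≤ t := by linarith [min_le_right h₀ (t - t₀)]
  exact _root_.gram_posDef hΦ H.coeff H.κ_pos hm
    (H.coercive _ hm (min_le_left _ _) (hm'.trans ht.2)) ⟨hm', ht.2⟩

/-- Only the last component of the drift depends on `d`, so the difference of the two responses has
first component of order `h^(p+1)`. Solving the least squares equation costs at most `h^p`, which
leaves the factor `T - t₀`. The constant `K` depends on the radius `R` but not on `T`. -/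
theorem contraction (H : S.Tame t₀ τ M κ h₀ y u) (hΦ : FundamentalMatrix t₀ τ (S.coeff y u) Φ)
    (R : ℝ) : ∃ K, 0 ≤ K ∧ ∀ T, t₀ < T → T ≤ τ → T ≤ t₀ + h₀ → T ≤ t₀ + 1 →
      ∀ (d₁ d₂ : ℝ → Vec (p + 1)) (D : ℝ), 0 ≤ D → ContinuousOn d₁ (Icc t₀ T) →
      ContinuousOn d₂ (Icc t₀ T) → (∀ s ∈ Icc t₀ T, ‖d₁ s‖ ≤ R) → (∀ s ∈ Icc t₀ T, ‖d₂ s‖ ≤ R) →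
      (∀ s ∈ Icc t₀ T, ‖d₁ s - d₂ s‖ ≤ D) →
      ‖((S.toControlSystem.Psi t₀ u Φ T)⁻¹).act
        (S.toControlSystem.Xi t₀ y u Φ d₁ T - S.toControlSystem.Xi t₀ y u Φ d₂ T)‖ ≤
          K * (T - t₀) * D ∧
      ∀ t ∈ Icc t₀ T, ‖S.toControlSystem.iterOp t₀ y u Φ T d₁ t -
        S.toControlSystem.iterOp t₀ y u Φ T d₂ t‖ ≤ K * (T - t₀) * D := by
  obtain ⟨L, hL, hlip⟩ := H.lipschitz R
  have hM := H.one_le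
  have hκ := H.κ_pos
  set V := M ^ p * M ^ p * L / κ with hV
  have hV0 : 0 ≤ V := by positivity
  refine ⟨V + (p + 1) * (M ^ p * V + M ^ p * L), by positivity, ?_⟩
  intro T hT hTτ hTh hT1 d₁ d₂ D hD hc₁ hc₂ hR₁ hR₂ hdD
  obtain ⟨h, rfl⟩ : ∃ h, T = t₀ + h := ⟨T - t₀, by ring⟩
  have hh : 0 < h := by linarith
  have hh1 : h ≤ 1 := by linarith
  have hTmem : t₀ + h ∈ Icc t₀ τ := ⟨hT.le, hTτ⟩
  have hΦT := hΦ.mono hTτ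
  have hbT := H.coeff.mono hTτ
  have hg₁ := H.integrable _ hTmem d₁ hc₁
  have hg₂ := H.integrable _ hTmem d₂ hc₂
  rw [add_sub_cancel_left]
  set g : ℝ → Vec (p + 1) := fun s => S.drift y u d₁ s - S.drift y u d₂ s with hg
  have hgi : ∀ i, IntervalIntegrable (fun s => g s i) volume t₀ (t₀ + h) := fun i =>
    (hg₁ i).sub (hg₂ i)
  -- `ξ` is the zero-initial-value response of the chain to the difference `g` of the two drifts.
  set ξ : ℝ → Fin (p + 1) → ℝ := fun t => Φ t *ᵥ transported t₀ Φ g t with hξ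
  have hξchain : SolvesChain t₀ (t₀ + h) (S.coeff y u) (fun i s => g s i) (fun i t => ξ t i) := by
    have := solvesChain_transported hΦT hbT hT.le hgi 0
    simpa only [zero_add] using this
  have hξ0 : ∀ i, ξ t₀ i = 0 := by
    intro i
    have h0 : transported t₀ Φ g t₀ = 0 := funext fun k => transported_self k
    simp [hξ, h0]
  have hg0 : ∀ (i : Fin p) s, g s i.castSucc = 0 := by
    intro i s
    simp [hg, drift_castSucc]
  have hglast : ∀ᵐ s ∂(volume.restrict (Icc t₀ (t₀ + h))), |g s (Fin.last p)| ≤ L * D := by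
    filter_upwards [ae_mono (Measure.restrict_mono (Icc_subset_Icc_right hTτ) le_rfl) hlip,
      ae_restrict_mem measurableSet_Icc] with s hs hs'
    exact (hs _ _ (hR₁ s hs') (hR₂ s hs')).trans (mul_le_mul_of_nonneg_left (hdD s hs') hL)
  have hLD : 0 ≤ L * D := by positivity
  have hη : ∀ t ∈ Icc t₀ (t₀ + h), |ξ t 0| ≤ M ^ p * (h ^ (p + 1) * (L * D)) := by
    intro t ht
    have := hξchain.abs_zero_le hT.le hM hLD hbT hg0 hglast t ht
    simpa [hξ0] using this
  have hξall : ∀ i, ∀ t ∈ Icc t₀ (t₀ + h), |ξ t i| ≤ M ^ p * (h * (L * D)) := by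
    intro i t ht
    have := hξchain.abs_le hT.le hT1 hM hLD hbT hg0 hglast i t ht
    simpa [hξ0] using this
  set v : Vec (p + 1) := ((S.toControlSystem.Psi t₀ u Φ (t₀ + h))⁻¹).act
    (S.toControlSystem.Xi t₀ y u Φ d₁ (t₀ + h) - S.toControlSystem.Xi t₀ y u Φ d₂ (t₀ + h)) with hv
  have hXi : ∀ i, (S.toControlSystem.Xi t₀ y u Φ d₁ (t₀ + h) -
      S.toControlSystem.Xi t₀ y u Φ d₂ (t₀ + h)) i =
      ∫ s in t₀..(t₀ + h), Φ s 0 i * ξ s 0 := by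
    intro i
    have hci : ∀ {d}, (∀ i, IntervalIntegrable (fun s => S.drift y u d s i) volume t₀ (t₀ + h)) →
        IntervalIntegrable (fun ρ => Φ ρ 0 i * (Φ ρ *ᵥ transported t₀ Φ (S.drift y u d) ρ) 0)
          volume t₀ (t₀ + h) := by
      intro d hgd
      refine ContinuousOn.intervalIntegrable ?_
      rw [uIcc_of_le hT.le]
      exact (hΦT.continuousOn_entry 0 i).mul (continuousOn_mulVec_transported hΦT hT.le hgd 0)
    rw [PiLp.sub_apply, S.Xi_apply hΦT hT.le hg₁, S.Xi_apply hΦT hT.le hg₂,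
      ← intervalIntegral.integral_sub (hci hg₁) (hci hg₂)]
    refine intervalIntegral.integral_congr fun s hs => ?_
    rw [uIcc_of_le hT.le] at hs
    simp only [hξ, hg]
    rw [← transported_sub hΦT hT.le hg₁ hg₂ hs, Matrix.mulVec_sub, Pi.sub_apply, mul_sub]
  have hdet : IsUnit (gram t₀ Φ (t₀ + h)).det :=
    (Matrix.isUnit_iff_isUnit_det _).1 (H.gram_posDef hΦ ⟨hT, hTτ⟩).isUnit
  have hsolve : gram t₀ Φ (t₀ + h) *ᵥ v.ofLp = fun i => ∫ s in t₀..(t₀ + h), Φ s 0 i * ξ s 0 := by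
    have : v.ofLp = (gram t₀ Φ (t₀ + h))⁻¹ *ᵥ (S.toControlSystem.Xi t₀ y u Φ d₁ (t₀ + h) -
      S.toControlSystem.Xi t₀ y u Φ d₂ (t₀ + h)).ofLp := by rw [hv, Psi_eq_gram]; rfl
    rw [this, Matrix.mulVec_mulVec, Matrix.mul_nonsing_inv _ hdet, Matrix.one_mulVec]
    exact funext hXi
  have hbound := gram_solution_bound hΦT hbT hM hh (H.coercive h hh (by linarith) hTτ)
    (hξchain.cont 0) hη hsolve
  -- As `h ≤ 1`, every weight `h^j` is at least `h^p`; cancelling `h^p` against `h^(p+1)` leaves one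
  -- factor `h`.
  have hsum : ∑ j, |v j| ≤ V * h * D := by
    have h1 : h ^ p * ∑ j, |v j| ≤ ∑ j : Fin (p + 1), h ^ (j : ℕ) * |v j| := by
      rw [Finset.mul_sum]
      refine Finset.sum_le_sum fun j _ => mul_le_mul_of_nonneg_right ?_ (abs_nonneg _)
      exact pow_le_pow_of_le_one hh.le hh1 (by omega)
    have h2 : h ^ p * (κ * ∑ j, |v j|) ≤ h ^ p * (M ^ p * M ^ p * L * h * D) := by
      calc _ = κ * (h ^ p * ∑ j, |v j|) := by ring
        _ ≤ _ := mul_le_mul_of_nonneg_left h1 hκ.le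
        _ ≤ _ := hbound
        _ = _ := by ring
    have h3 := le_of_mul_le_mul_left h2 (by positivity)
    calc _ ≤ (M ^ p * M ^ p * L * h * D) / κ := by rw [le_div_iff₀ hκ]; linarith
      _ = _ := by rw [hV]; ring
  refine ⟨(norm_le_sum_abs v).trans (hsum.trans ?_), fun t ht => ?_⟩
  · gcongr
    exact le_add_of_nonneg_right (by positivity)
  -- The term in `y` is the same for `d₁` and `d₂`, so only the correction `-Φ v` of the initial
  -- state and the response `ξ` survive.
  · have hdiff : ∀ i, (S.toControlSystem.iterOp t₀ y u Φ (t₀ + h) d₁ t -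
        S.toControlSystem.iterOp t₀ y u Φ (t₀ + h) d₂ t) i = -(Φ t *ᵥ v.ofLp) i + ξ t i := by
      intro i
      have hvv : v.ofLp = (gram t₀ Φ (t₀ + h))⁻¹ *ᵥ (S.toControlSystem.Xi t₀ y u Φ d₁ (t₀ + h) -
        S.toControlSystem.Xi t₀ y u Φ d₂ (t₀ + h)).ofLp := by rw [hv, Psi_eq_gram]; rfl
      rw [PiLp.sub_apply, S.iterOp_apply hΦT hT.le hg₁ ht, S.iterOp_apply hΦT hT.le hg₂ ht, hvv]
      simp only [hξ, hg]
      rw [← transported_sub hΦT hT.le hg₁ hg₂ ht]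
      simp only [WithLp.ofLp_sub, Matrix.mulVec_sub, Matrix.mulVec_add, Pi.sub_apply, Pi.add_apply]
      ring
    have hΦv : ∀ i, |(Φ t *ᵥ v.ofLp) i| ≤ M ^ p * (V * h * D) := by
      intro i
      have hx := hΦT.solvesChain_mulVec hbT hT.le v.ofLp
      have := hx.abs_le (G := 0) hT.le hT1 hM le_rfl hbT (fun _ _ => rfl) (by simp) i t ht
      simp only [hΦ.init, Matrix.one_mulVec, mul_zero, add_zero] at this
      exact this.trans (mul_le_mul_of_nonneg_left hsum (by positivity))
    refine (norm_le_sum_abs _).trans ?_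
    calc _ ≤ ∑ _i : Fin (p + 1), (M ^ p * (V * h * D) + M ^ p * (h * (L * D))) := by
          refine Finset.sum_le_sum fun i _ => ?_
          rw [hdiff]
          refine (abs_add_le _ _).trans (add_le_add ?_ (hξall i t ht))
          rw [abs_neg]; exact hΦv i
      _ = (p + 1) * (M ^ p * V + M ^ p * L) * h * D := by
          rw [Finset.sum_const, Finset.card_univ, Fintype.card_fin, nsmul_eq_mul]
          push_cast; ring
      _ ≤ _ := by
          gcongr
          exact le_add_of_nonneg_left hV0

/-- The solution is a fixed point of the iteration operators. -/
theorem iterOp_eq_self (H : S.Tame t₀ τ M κ h₀ y u)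
    (hΦ : FundamentalMatrix t₀ τ (S.coeff y u) Φ) {x₀ : Vec (p + 1)} {x : ℝ → Vec (p + 1)}
    (hx : S.toControlSystem.IsSolution t₀ τ u x₀ x)
    (hy : ∀ᵐ t ∂(volume.restrict (Icc t₀ τ)), y t = (S.toControlSystem.C t (u t)).act (x t))
    {T : ℝ} (hT : T ∈ Ioc t₀ τ) {t : ℝ} (ht : t ∈ Icc t₀ T) :
    S.toControlSystem.iterOp t₀ y u Φ T x t = x t := by
  obtain ⟨hchain, hx0⟩ := S.solvesChain_of_isSolution H.lt.le hx hy
  have hTτ := hT.2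
  have hT0 := hT.1.le
  have hΦT := hΦ.mono hTτ
  have hbT := H.coeff.mono hTτ
  have hg := H.integrable T ⟨hT0, hTτ⟩ x (hx.continuousOn.mono (Icc_subset_Icc_right hTτ))
  set w := transported t₀ Φ (S.drift y u x) with hw
  have hxeq : ∀ s ∈ Icc t₀ T, ∀ i, x s i = (Φ s *ᵥ (x₀.ofLp + w s)) i := by
    intro s hs i
    refine (hchain.mono hTτ).eqOn (solvesChain_transported hΦT hbT hT0 hg x₀.ofLp) (fun i => ?_) i hs
    have h0 : transported t₀ Φ (S.drift y u x) t₀ = 0 := funext fun k => transported_self k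
    rw [h0, hΦ.init, Matrix.one_mulVec, add_zero, hx0]
  have hint1 : ∀ i, IntervalIntegrable (fun s => Φ s 0 i * (Φ s *ᵥ x₀.ofLp) 0) volume t₀ T := by
    intro i
    refine ContinuousOn.intervalIntegrable ?_
    rw [uIcc_of_le hT0]
    exact (hΦT.continuousOn_entry 0 i).mul
      (continuousOn_mulVec_zero (fun j => hΦT.continuousOn_entry 0 j) _)
  have hint2 : ∀ i, IntervalIntegrable (fun s => Φ s 0 i * (Φ s *ᵥ w s) 0) volume t₀ T := by
    intro i
    refine ContinuousOn.intervalIntegrable ?_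
    rw [uIcc_of_le hT0]
    exact (hΦT.continuousOn_entry 0 i).mul (continuousOn_mulVec_transported hΦT hT0 hg 0)
  have hyae : ∀ᵐ s : ℝ, s ∈ uIoc t₀ T → ∀ i, (((Φ s)ᵀ * (S.toControlSystem.C s (u s))ᵀ).act (y s)) i =
      Φ s 0 i * (Φ s *ᵥ x₀.ofLp) 0 + Φ s 0 i * (Φ s *ᵥ w s) 0 := by
    filter_upwards [(ae_restrict_iff' measurableSet_Icc).1 hy] with s hs hs' i
    rw [uIoc_of_le hT0] at hs'
    have hsT : s ∈ Icc t₀ T := ⟨hs'.1.le, hs'.2⟩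
    have h1 : y s 0 = x s 0 := by rw [hs ⟨hsT.1, hsT.2.trans hTτ⟩, C_act]
    rw [Matrix.act_apply, ← mul_add, ← Pi.add_apply, ← Matrix.mulVec_add, ← hxeq s hsT 0, ← h1]
    simp [Matrix.mulVec, dotProduct, transpose_mul_transpose_C]
  -- By variation of constants the output is the first component of `Φ x₀ + Φ w`. `Xi` removes the
  -- contribution of `w`, so `Ψ⁻¹` recovers `x₀` exactly.
  have hP : ((∫ ρ in t₀..T, ((Φ ρ)ᵀ * (S.toControlSystem.C ρ (u ρ))ᵀ).act (y ρ)) -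
      S.toControlSystem.Xi t₀ y u Φ x T).ofLp = gram t₀ Φ T *ᵥ x₀.ofLp := by
    ext i
    rw [gram_mulVec (fun j => hΦT.continuousOn_entry 0 j) (right_mem_Icc.2 hT0) x₀.ofLp i]
    change ((∫ ρ in t₀..T, ((Φ ρ)ᵀ * (S.toControlSystem.C ρ (u ρ))ᵀ).act (y ρ)) -
      S.toControlSystem.Xi t₀ y u Φ x T) i = _
    rw [PiLp.sub_apply, S.Xi_apply hΦT hT0 hg, intervalIntegral_apply, sub_eq_iff_eq_add,
      ← intervalIntegral.integral_add (hint1 i) (hint2 i)]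
    · refine intervalIntegral.integral_congr_ae ?_
      filter_upwards [hyae] with s hs hs'
      exact hs hs' i
    · intro i
      refine ((hint1 i).add (hint2 i)).congr_ae ?_
      refine (ae_restrict_iff' measurableSet_uIoc).2 ?_
      filter_upwards [hyae] with s hs hs'
      exact (hs hs' i).symm
  have hdet : IsUnit (gram t₀ Φ T).det :=
    (Matrix.isUnit_iff_isUnit_det _).1 (H.gram_posDef hΦ hT).isUnit
  ext i
  rw [S.iterOp_apply hΦT hT0 hg ht, hP, Matrix.mulVec_mulVec, Matrix.nonsing_inv_mul _ hdet,
    Matrix.one_mulVec, hxeq t ht]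

end Tame

end TriangularSystem

/-! ### Density points, and tameness of the outputs that start there -/

theorem exists_ae_norm_le_of_memLp_top {n : ℕ} {μ : Measure ℝ} {g : ℝ → Vec n}
    (hg : MemLp g (⊤ : ℝ≥0∞) μ) : ∃ r : ℝ, ∀ᵐ t ∂μ, ‖g t‖ ≤ r := by
  refine ⟨(eLpNormEssSup g μ).toReal, ?_⟩
  have hfin : eLpNormEssSup g μ ≠ ∞ := by
    rw [← eLpNorm_exponent_top]; exact hg.2.ne
  filter_upwards [ae_le_eLpNormEssSup (f := g) (μ := μ)] with t ht
  rw [← toReal_enorm]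
  exact ENNReal.toReal_mono hfin ht

namespace ControlSystem

variable {n k m : ℕ} {S : ControlSystem n k m}

theorem IsSolution.congr_input {t₀ τ τ' : ℝ} {u u' : ℝ → Vec m} {x₀ : Vec n} {x : ℝ → Vec n}
    (h : S.IsSolution t₀ τ u x₀ x) (hτ : t₀ ≤ τ') (hτ' : τ' ≤ τ)
    (hu : u =ᵐ[volume.restrict (Icc t₀ τ')] u') : S.IsSolution t₀ τ' u' x₀ x := by
  have hu' := (ae_restrict_iff' measurableSet_Icc).1 hu
  refine ⟨h.continuousOn.mono (Icc_subset_Icc_right hτ'), ?_, fun t ht => ?_⟩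
  · have h1 : IntervalIntegrable (fun s => S.rhs s (x s) (u s)) volume t₀ τ' := by
      refine h.integrable.mono_set ?_
      rw [uIcc_of_le hτ, uIcc_of_le (hτ.trans hτ')]; exact Icc_subset_Icc_right hτ'
    refine h1.congr_ae ((ae_restrict_iff' measurableSet_uIoc).2 ?_)
    filter_upwards [hu'] with s hs hs'
    rw [uIoc_of_le hτ] at hs'
    rw [hs ⟨hs'.1.le, hs'.2⟩]
  · rw [h.eq t (Icc_subset_Icc_right hτ' ht)]
    congr 1
    refine intervalIntegral.integral_congr_ae ?_
    filter_upwards [hu'] with s hs hs'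
    rw [uIoc_of_le ht.1] at hs'
    rw [hs ⟨hs'.1.le, hs'.2.trans ht.2⟩]

end ControlSystem

namespace TriangularSystem

variable {p m : ℕ} (S : TriangularSystem p m)

/-- The times at which `a i` has the sign `σ` and absolute value at least `q` for all `y` in
`[q₁,q₂]` and all `u` of norm at most `N`. -/
def signSet (i : Fin p) (σ : Bool) (q₁ q₂ : ℚ) (N : ℕ) (q : ℚ) : Set ℝ :=
  {t | t ∈ Ici (0 : ℝ) ∧ ∀ z ∈ Icc (q₁ : ℝ) q₂ ×ˢ Metric.closedBall (0 : Vec m) N,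
    (q : ℝ) ≤ (bif σ then 1 else -1) * S.a i t z.1 z.2}

/-- `t₀` is a point of right density of each of the sets `S.signSet` to which it belongs. -/
def IsDensityPoint (t₀ : ℝ) : Prop :=
  ∀ i σ q₁ q₂ N q, t₀ ∈ S.signSet i σ q₁ q₂ N q → ∀ ε > (0 : ℝ), ∀ᶠ h in 𝓝[>] (0 : ℝ),
    volume (Icc t₀ (t₀ + h) \ S.signSet i σ q₁ q₂ N q) ≤ ENNReal.ofReal (ε * h)

variable {S}

/-- Rational bounds and integer radii leave countably many sets, so one null set of exceptional
times serves all inputs and outputs. -/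
theorem Regular.ae_isDensityPoint (hS : S.Regular) : ∀ᵐ t₀ : ℝ, S.IsDensityPoint t₀ := by
  have h := ae_right_density
    (fun k : Fin p × Bool × ℚ × ℚ × ℕ × ℚ =>
      S.signSet k.1 k.2.1 k.2.2.1 k.2.2.2.1 k.2.2.2.2.1 k.2.2.2.2.2) (fun k => by
    refine nullMeasurableSet_forall_le (g := fun t (z : ℝ × Vec m) =>
      (bif k.2.1 then 1 else -1) * S.a k.1 t z.1 z.2) measurableSet_Ici (fun z => ?_)
      (fun t ht => ?_) _ _
    · exact (hS.a_meas k.1 z.1 z.2).const_mul _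
    · exact continuous_const.mul (hS.a_cont k.1 t ht))
  filter_upwards [h] with t ht i σ q₁ q₂ N q hmem
  exact ht (i, σ, q₁, q₂, N, q) hmem

/-- A continuous function without zeros on the connected space of input values has one sign. Its
absolute value has a positive minimum on the compact ball of radius `N`, and the tube lemma carries
a smaller rational bound to a neighbourhood of `y₀`. -/
theorem Regular.exists_mem_signSet (hS : S.Regular) {t₀ y₀ : ℝ} (ht₀ : 0 ≤ t₀) (i : Fin p)
    (hne : ∀ u, S.a i t₀ y₀ u ≠ 0) (N : ℕ) :
    ∃ σ, ∃ q₁ q₂ q : ℚ, (q₁ : ℝ) < y₀ ∧ y₀ < q₂ ∧ (0 : ℝ) < q ∧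
      t₀ ∈ S.signSet i σ q₁ q₂ N q := by
  have hcont := hS.a_cont i t₀ ht₀
  have hcu : Continuous fun u => S.a i t₀ y₀ u :=
    hcont.comp (continuous_const.prodMk continuous_id)
  obtain ⟨σ, hσ⟩ : ∃ σ : Bool, ∀ u, 0 < (bif σ then (1 : ℝ) else -1) * S.a i t₀ y₀ u := by
    rcases (hne 0).lt_or_gt with h0 | h0
    · refine ⟨false, fun u => ?_⟩
      by_contra hneg
      have hu : 0 ≤ S.a i t₀ y₀ u := by simpa using hneg
      obtain ⟨v, hv⟩ := mem_range_of_exists_le_of_exists_ge hcu ⟨0, h0.le⟩ ⟨u, hu⟩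
      exact hne v hv
    · refine ⟨true, fun u => ?_⟩
      by_contra hneg
      have hu : S.a i t₀ y₀ u ≤ 0 := by simpa using hneg
      obtain ⟨v, hv⟩ := mem_range_of_exists_le_of_exists_ge hcu ⟨u, hu⟩ ⟨0, h0.le⟩
      exact hne v hv
  set F : ℝ × Vec m → ℝ := fun z => (bif σ then (1 : ℝ) else -1) * S.a i t₀ z.1 z.2 with hF
  have hFc : Continuous F := continuous_const.mul hcont
  obtain ⟨u₁, -, hu₁⟩ := (isCompact_closedBall (0 : Vec m) N).exists_isMinOn
    ⟨0, Metric.mem_closedBall_self (Nat.cast_nonneg N)⟩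
    (f := fun u => F (y₀, u)) (hFc.comp (continuous_const.prodMk continuous_id)).continuousOn
  obtain ⟨q, hq0, hq⟩ := exists_rat_btwn (hσ u₁)
  have hopen : IsOpen {z | (q : ℝ) < F z} := isOpen_lt continuous_const hFc
  obtain ⟨O, W, hO, -, hyO, hW, hOW⟩ := generalized_tube_lemma (isCompact_singleton (x := y₀))
    (isCompact_closedBall (0 : Vec m) N) hopen (by
      rintro ⟨y, u⟩ ⟨hy, hu⟩
      rw [mem_singleton_iff] at hy
      subst hy
      exact lt_of_lt_of_le hq (hu₁ hu))
  obtain ⟨l, r, hlr, hsub⟩ := mem_nhds_iff_exists_Ioo_subset.1 (hO.mem_nhds (hyO rfl))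
  obtain ⟨q₁, hq₁, hq₁'⟩ := exists_rat_btwn hlr.1
  obtain ⟨q₂, hq₂, hq₂'⟩ := exists_rat_btwn hlr.2
  refine ⟨σ, q₁, q₂, q, hq₁', hq₂, by exact_mod_cast hq0, ht₀, fun z hz => ?_⟩
  have hz' : z ∈ O ×ˢ W := ⟨hsub ⟨hq₁.trans_le hz.1.1, hz.1.2.trans_lt hq₂'⟩, hW hz.2⟩
  exact le_of_lt (hOW hz')

/-- At a time at which the observability condition holds the coefficients do not vanish at the
initial output of a solution, whatever the value of the input. -/
theorem ObservabilityCondition.ne_zero {I : Set ℝ} (hI : S.ObservabilityCondition I) {t₀ τ : ℝ}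
    (ht₀ : t₀ ∈ I) (hτ : t₀ < τ) {u : ℝ → Vec m} (hu : u ∈ allInputs m t₀ τ) {x₀ : Vec (p + 1)}
    {x : ℝ → Vec (p + 1)} (hx : S.toControlSystem.IsSolution t₀ τ u x₀ x) (i : Fin p)
    (u₀ : Vec m) : S.a i t₀ (x₀ 0) u₀ ≠ 0 := by
  obtain ⟨δ, hδ, H⟩ := hI.2.2.2 t₀ ht₀
  obtain ⟨τ', hτ'₁, hτ'₂⟩ := exists_between (lt_min hτ (show t₀ < t₀ + δ by linarith))
  have hτ'τ : τ' ≤ τ := (hτ'₂.trans_le (min_le_left _ _)).le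
  -- Changing the input at one time affects neither its class nor the solution, yet gives `u(t₀)`
  -- any value. The shorter interval up to `τ'` is needed because the condition holds only for end
  -- times near `t₀`.
  set u' := Function.update u t₀ u₀ with hu'
  have hae : u =ᵐ[volume.restrict (Icc t₀ τ')] u' := by
    refine ae_restrict_of_ae ?_
    have : ∀ᵐ t : ℝ, t ≠ t₀ := by simp [ae_iff]
    filter_upwards [this] with t ht
    rw [hu', Function.update_of_ne ht]
  have hx' := hx.congr_input hτ'₁.le hτ'τ hae
  set y' : ℝ → Vec 1 := fun t => (S.toControlSystem.C t (u' t)).act (x t) with hy'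
  have hyc : ContinuousOn y' (Icc t₀ τ') := by
    have hx0 : ContinuousOn (fun t => x t 0) (Icc t₀ τ') :=
      (PiLp.continuous_apply 2 (fun _ => ℝ) 0).comp_continuousOn hx'.continuousOn
    refine ((PiLp.continuous_toLp 2 (fun _ : Fin 1 => ℝ)).comp_continuousOn
      (continuousOn_pi.2 fun _ => hx0)).congr fun t _ => ?_
    ext j
    exact C_act S t (u' t) (x t) j
  have hout : y' ∈ S.toControlSystem.outputs t₀ τ' u' := by
    refine ⟨?_, x₀, x, hx', Eventually.of_forall fun t => rfl⟩
    obtain ⟨B, hB⟩ := isCompact_Icc.exists_bound_of_continuousOn hyc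
    exact memLp_top_of_bound (hyc.aestronglyMeasurable measurableSet_Icc) B
      ((ae_restrict_iff' measurableSet_Icc).2 (Eventually.of_forall hB))
  have hin : u' ∈ allInputs m t₀ τ' := by
    have h1 : MemLp u (⊤ : ℝ≥0∞) (volume.restrict (Icc t₀ τ')) :=
      MemLp.mono_measure (Measure.restrict_mono (Icc_subset_Icc_right hτ'τ) le_rfl) hu
    exact h1.ae_eq hae
  have h := H τ' ⟨hτ'₁, hτ'₂.trans_le (min_le_right _ _)⟩ u' hin y' hout hyc
  have h1 := Finset.prod_ne_zero_iff.1 h i (Finset.mem_univ _)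
  have hx0 : x t₀ = x₀ := by simpa using hx'.eq t₀ (left_mem_Icc.2 hτ'₁.le)
  rwa [show y' t₀ 0 = x₀ 0 by rw [hy']; simp only [C_act, hx0], hu', Function.update_self] at h1

theorem norm_toLp_update_le (v : Vec (p + 1)) (c : ℝ) :
    ‖(WithLp.toLp 2 (Function.update v.ofLp 0 c) : Vec (p + 1))‖ ≤ (p + 1) * (‖v‖ + |c|) := by
  refine (norm_le_sum_abs _).trans ?_
  calc _ ≤ ∑ _i : Fin (p + 1), (‖v‖ + |c|) := by
        refine Finset.sum_le_sum fun i _ => ?_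
        by_cases hi : i = 0
        · subst hi
          simp
        · simp only [Function.update_of_ne hi]
          linarith [abs_apply_le_norm v i, abs_nonneg c]
    _ = _ := by simp; ring

theorem norm_toLp_update_sub_le (v w : Vec (p + 1)) (c : ℝ) :
    ‖(WithLp.toLp 2 (Function.update v.ofLp 0 c) : Vec (p + 1)) -
      WithLp.toLp 2 (Function.update w.ofLp 0 c)‖ ≤ ‖v - w‖ := by
  rw [EuclideanSpace.norm_eq, EuclideanSpace.norm_eq]
  refine Real.sqrt_le_sqrt (Finset.sum_le_sum fun i _ => ?_)
  by_cases hi : i = 0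
  · subst hi
    simp
    positivity
  · simp [Function.update_of_ne hi]

section Along

variable {t₀ τ : ℝ} {y : ℝ → Vec 1} {u : ℝ → Vec m}

theorem Regular.exists_boundedCoeff (hS : S.Regular) (ht₀ : 0 ≤ t₀)
    (hy : AEMeasurable y (volume.restrict (Icc t₀ τ)))
    (hu : AEMeasurable u (volume.restrict (Icc t₀ τ))) {r : ℝ}
    (hyr : ∀ᵐ t ∂(volume.restrict (Icc t₀ τ)), |y t 0| ≤ r)
    (hur : ∀ᵐ t ∂(volume.restrict (Icc t₀ τ)), ‖u t‖ ≤ r) :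
    ∃ M, 1 ≤ M ∧ BoundedCoeff t₀ τ M (S.coeff y u) := by
  -- The hypothesis uses a single radius for `t`, `y` and `u`.
  choose B hB using fun i => hS.a_bdd i (max r τ)
  have hsub : Icc t₀ τ ⊆ Ici 0 := fun t ht => ht₀.trans ht.1
  have hsum : 0 ≤ ∑ i, |B i| := Finset.sum_nonneg fun _ _ => abs_nonneg _
  refine ⟨1 + ∑ i, |B i|, by linarith, fun i => ?_, fun i => ?_⟩
  · refine (aemeasurable_caratheodory (g := fun t (z : ℝ × Vec m) => S.a i t z.1 z.2)
      (fun z => (hS.a_meas i z.1 z.2).mono_measure (Measure.restrict_mono hsub le_rfl)) ?_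
      (φ := fun t => (y t 0, u t)) ?_).aestronglyMeasurable
    · filter_upwards [ae_restrict_mem measurableSet_Icc] with t ht
      exact hS.a_cont i t (hsub ht)
    · exact ((PiLp.continuous_apply 2 (fun _ : Fin 1 => ℝ) 0).measurable.comp_aemeasurable hy).prodMk hu
  · have hsub' : Icc t₀ τ ⊆ Icc 0 (max r τ) := Icc_subset_Icc ht₀ (le_max_right _ _)
    filter_upwards [ae_mono (Measure.restrict_mono hsub' le_rfl) (hB i), hyr, hur] with t ht h1 h2
    refine (ht _ _ (h1.trans (le_max_left _ _)) (h2.trans (le_max_left _ _))).trans ?_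
    have := Finset.single_le_sum (f := fun i => |B i|) (fun i _ => abs_nonneg _) (Finset.mem_univ i)
    linarith [le_abs_self (B i)]

theorem Regular.drift_lipschitz (hS : S.Regular) (ht₀ : 0 ≤ t₀) {r : ℝ}
    (hyr : ∀ᵐ t ∂(volume.restrict (Icc t₀ τ)), |y t 0| ≤ r)
    (hur : ∀ᵐ t ∂(volume.restrict (Icc t₀ τ)), ‖u t‖ ≤ r) (R : ℝ) :
    ∃ L, 0 ≤ L ∧ ∀ᵐ s ∂(volume.restrict (Icc t₀ τ)), ∀ v w : Vec (p + 1),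
      ‖v‖ ≤ R → ‖w‖ ≤ R →
      |S.toControlSystem.f s (y s) v (u s) (Fin.last p) -
        S.toControlSystem.f s (y s) w (u s) (Fin.last p)| ≤ L * ‖v - w‖ := by
  -- The last entry bounds a state of norm at most `R` after its first coordinate is replaced by the
  -- output. Both states then share that coordinate, as the Lipschitz hypothesis requires.
  obtain ⟨L, hL⟩ := hS.fLast_lip_unif (max τ (max r ((p + 1) * (R + r))))
  refine ⟨|L|, abs_nonneg _, ?_⟩
  filter_upwards [hyr, hur, ae_restrict_mem measurableSet_Icc] with s h1 h2 h3 v w hv hw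
  have hnorm : ∀ v : Vec (p + 1), ‖v‖ ≤ R →
      ‖(WithLp.toLp 2 (Function.update v.ofLp 0 (y s 0)) : Vec (p + 1))‖ ≤
        max τ (max r ((p + 1) * (R + r))) := fun v hv =>
    (norm_toLp_update_le v _).trans ((mul_le_mul_of_nonneg_left (add_le_add hv h1)
      (by positivity)).trans ((le_max_right _ _).trans (le_max_right _ _)))
  have h := hL s ⟨ht₀.trans h3.1, h3.2.trans (le_max_left _ _)⟩ (u s)
    (h2.trans ((le_max_left _ _).trans (le_max_right _ _))) _ _ (hnorm v hv) (hnorm w hw) (by simp)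
  have e := fun v => S.drift_last y u (fun _ => v) s
  simp only [drift] at e
  rw [e, e]
  refine h.trans ((mul_le_mul_of_nonneg_right (le_abs_self L) (norm_nonneg _)).trans ?_)
  exact mul_le_mul_of_nonneg_left (norm_toLp_update_sub_le v w _) (abs_nonneg _)

theorem Regular.aemeasurable_drift_last (hS : S.Regular) {T : ℝ} (ht₀ : 0 ≤ t₀)
    (hy : AEMeasurable y (volume.restrict (Icc t₀ T)))
    (hu : AEMeasurable u (volume.restrict (Icc t₀ T))) {d : ℝ → Vec (p + 1)}
    (hd : AEMeasurable d (volume.restrict (Icc t₀ T))) :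
    AEMeasurable (fun s => S.drift y u d s (Fin.last p)) (volume.restrict (Icc t₀ T)) := by
  have hsub : Icc t₀ T ⊆ Ici 0 := fun t ht => ht₀.trans ht.1
  simp only [drift_last]
  refine aemeasurable_caratheodory (g := fun t (z : Vec (p + 1) × Vec m) => S.fLast t z.1 z.2)
    (fun z => (hS.fLast_meas z.1 z.2).mono_measure (Measure.restrict_mono hsub le_rfl)) ?_
    (φ := fun s => (WithLp.toLp 2 (Function.update (d s).ofLp 0 (y s 0)), u s)) ?_
  · filter_upwards [ae_restrict_mem measurableSet_Icc] with t ht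
    exact hS.fLast_cont t (hsub ht)
  · have hc : Continuous fun z : Vec (p + 1) × Vec 1 =>
        (WithLp.toLp 2 (Function.update z.1.ofLp 0 (z.2 0)) : Vec (p + 1)) := by
      refine (PiLp.continuous_toLp 2 _).comp (Continuous.update ?_ _ ?_)
      · exact (PiLp.continuous_ofLp 2 _).comp continuous_fst
      · exact (PiLp.continuous_apply 2 (fun _ : Fin 1 => ℝ) 0).comp continuous_snd
    exact (hc.measurable.comp_aemeasurable (hd.prodMk hy)).prodMk hu

/-- Along the solution the drift is the right-hand side minus `A x`: the former is integrable by the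
definition of a solution, the latter because the coefficients are essentially bounded. -/
theorem intervalIntegrable_drift_of_isSolution {M : ℝ} (hτ : t₀ ≤ τ)
    (hb : BoundedCoeff t₀ τ M (S.coeff y u)) {x₀ : Vec (p + 1)} {x : ℝ → Vec (p + 1)}
    (hx : S.toControlSystem.IsSolution t₀ τ u x₀ x)
    (hyx : ∀ᵐ t ∂(volume.restrict (Icc t₀ τ)), y t = (S.toControlSystem.C t (u t)).act (x t)) (i) :
    IntervalIntegrable (fun s => S.drift y u x s i) volume t₀ τ := by
  have hA : IntervalIntegrable
      (fun s => (S.toControlSystem.A s (y s) (u s) *ᵥ (x s).ofLp) i) volume t₀ τ := by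
    refine Fin.lastCases ?_ (fun i => ?_) i
    · simp only [A_mulVec_last]
      exact intervalIntegrable_const
    · simp only [A_mulVec_castSucc]
      exact hb.intervalIntegrable_mul i
        ((PiLp.continuous_apply 2 (fun _ => ℝ) i.succ).comp_continuousOn hx.continuousOn)
        (left_mem_Icc.2 hτ) (right_mem_Icc.2 hτ)
  refine ((hx.integrable.vec_apply i).sub hA).congr_ae ((ae_restrict_iff' measurableSet_uIoc).2 ?_)
  filter_upwards [(ae_restrict_iff' measurableSet_Icc).1 hyx] with s hs hs'
  rw [uIoc_of_le hτ] at hs'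
  rw [ControlSystem.rhs, ← hs ⟨hs'.1.le, hs'.2⟩, PiLp.add_apply]
  simp only [drift, Matrix.act_apply]
  ring

/-- The bounds assumed on the drift hold only for fixed states and inputs, so integrability is taken
over from the solution `x`. All components but the last do not involve `d`, and the last differs
from its value along `x` by a bounded function, thanks to the Lipschitz condition. -/
theorem Regular.intervalIntegrable_drift (hS : S.Regular) {M : ℝ} (ht₀ : 0 ≤ t₀) (hτ : t₀ ≤ τ)
    (hy : AEMeasurable y (volume.restrict (Icc t₀ τ)))
    (hu : AEMeasurable u (volume.restrict (Icc t₀ τ))) {r : ℝ}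
    (hyr : ∀ᵐ t ∂(volume.restrict (Icc t₀ τ)), |y t 0| ≤ r)
    (hur : ∀ᵐ t ∂(volume.restrict (Icc t₀ τ)), ‖u t‖ ≤ r)
    (hb : BoundedCoeff t₀ τ M (S.coeff y u)) {x₀ : Vec (p + 1)} {x : ℝ → Vec (p + 1)}
    (hx : S.toControlSystem.IsSolution t₀ τ u x₀ x)
    (hyx : ∀ᵐ t ∂(volume.restrict (Icc t₀ τ)), y t = (S.toControlSystem.C t (u t)).act (x t))
    {T : ℝ} (hT : T ∈ Icc t₀ τ) {d : ℝ → Vec (p + 1)} (hd : ContinuousOn d (Icc t₀ T)) (i) :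
    IntervalIntegrable (fun s => S.drift y u d s i) volume t₀ T := by
  have hxi := fun i => intervalIntegrable_of_mem_Icc hT
    (intervalIntegrable_drift_of_isSolution hτ hb hx hyx i)
  refine Fin.lastCases ?_ (fun i => ?_) i
  · have hle : volume.restrict (Icc t₀ T) ≤ volume.restrict (Icc t₀ τ) :=
      Measure.restrict_mono (Icc_subset_Icc_right hT.2) le_rfl
    have hxc : ContinuousOn x (Icc t₀ T) := hx.continuousOn.mono (Icc_subset_Icc_right hT.2)
    obtain ⟨B₁, hB₁⟩ := isCompact_Icc.exists_bound_of_continuousOn hd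
    obtain ⟨B₂, hB₂⟩ := isCompact_Icc.exists_bound_of_continuousOn hxc
    obtain ⟨L, hL, hlip⟩ := hS.drift_lipschitz ht₀ hyr hur (max B₁ B₂)
    have hm := fun {d : ℝ → Vec (p + 1)} (hd : ContinuousOn d (Icc t₀ T)) =>
      hS.aemeasurable_drift_last ht₀ (hy.mono_measure hle) (hu.mono_measure hle)
        (hd.aemeasurable measurableSet_Icc)
    have hdiff : IntegrableOn (fun s => S.drift y u d s (Fin.last p) -
        S.drift y u x s (Fin.last p)) (Icc t₀ T) := by
      refine ⟨((hm hd).sub (hm hxc)).aestronglyMeasurable,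
        HasFiniteIntegral.of_bounded (C := L * (max B₁ B₂ + max B₁ B₂)) ?_⟩
      filter_upwards [ae_mono hle hlip, ae_restrict_mem measurableSet_Icc] with s hs hs'
      have h1 := (hB₁ s hs').trans (le_max_left _ B₂)
      have h2 := (hB₂ s hs').trans (le_max_right B₁ _)
      exact (hs _ _ h1 h2).trans (mul_le_mul_of_nonneg_left
        ((norm_sub_le _ _).trans (add_le_add h1 h2)) hL)
    have h3 : IntervalIntegrable (fun s => S.drift y u d s (Fin.last p) -
        S.drift y u x s (Fin.last p)) volume t₀ T := by
      refine IntegrableOn.intervalIntegrable ?_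
      rwa [uIcc_of_le hT.1]
    have h4 := h3.add (hxi (Fin.last p))
    convert! h4 using 1
    ext s
    simp
  · have := hxi i.castSucc
    simp only [drift_castSucc] at this ⊢
    exact this

/-- For a short time the output stays in the rational intervals around its initial value, so the
coefficients have the right sign and size at all times in the sign sets. Density at `t₀` makes the
remaining times negligible relative to `h`. -/
theorem Regular.exists_coercive (hS : S.Regular) {M : ℝ} (ht₀ : 0 ≤ t₀) (hτ : t₀ < τ)
    (hdens : S.IsDensityPoint t₀) {r : ℝ}
    (hur : ∀ᵐ t ∂(volume.restrict (Icc t₀ τ)), ‖u t‖ ≤ r) (hM : 1 ≤ M)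
    (hb : BoundedCoeff t₀ τ M (S.coeff y u)) {x : ℝ → ℝ}
    (hx : ContinuousOn x (Icc t₀ τ))
    (hyx : ∀ᵐ t ∂(volume.restrict (Icc t₀ τ)), y t 0 = x t)
    (hne : ∀ i u₀, S.a i t₀ (x t₀) u₀ ≠ 0) :
    ∃ κ > 0, ∃ h₀ > 0, ∀ h, 0 < h → h ≤ h₀ → t₀ + h ≤ τ → Coercive κ t₀ h (S.coeff y u) := by
  obtain ⟨N, hN⟩ := exists_nat_ge r
  choose σ q₁ q₂ q hq₁ hq₂ hq hmem using fun i => hS.exists_mem_signSet ht₀ i (hne i) N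
  -- Choosing `c` eventually near `0` instead of as a minimum covers `p = 0` as well.
  obtain ⟨c, hcq, hc⟩ : ∃ c : ℝ, (∀ i, c ≤ q i) ∧ 0 < c := by
    have : ∀ᶠ c in 𝓝[>] (0 : ℝ), ∀ i, c ≤ (q i : ℝ) := by
      refine eventually_all.2 fun i => ?_
      filter_upwards [Ioo_mem_nhdsGT (hq i)] with c hc using hc.2.le
    exact (this.and self_mem_nhdsWithin).exists
  obtain ⟨κ, hκ, ε, hε, H⟩ := exists_integral_sq_lower_bound hc hM p
  refine ⟨κ, hκ, ?_⟩
  -- The share `ε / (p + 1)` keeps the union of the `p` exceptional sets below `ε h`.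
  have hdens' : ∀ᶠ h in 𝓝[>] (0 : ℝ), ∀ i,
      volume (Icc t₀ (t₀ + h) \ S.signSet i (σ i) (q₁ i) (q₂ i) N (q i)) ≤
        ENNReal.ofReal (ε / (p + 1) * h) :=
    eventually_all.2 fun i => hdens _ _ _ _ _ _ (hmem i) _ (by positivity)
  have hval : ∀ᶠ s in 𝓝[Icc t₀ τ] t₀, ∀ i, (q₁ i : ℝ) < x s ∧ x s < q₂ i := by
    have hx0 := hx t₀ (left_mem_Icc.2 hτ.le)
    exact eventually_all.2 fun i => hx0.eventually (Ioo_mem_nhds (hq₁ i) (hq₂ i))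
  obtain ⟨h₁, hh₁, hsub₁⟩ := mem_nhdsGT_iff_exists_Ioc_subset.1 hdens'
  obtain ⟨h₂, hh₂, hsub₂⟩ := Metric.mem_nhdsWithin_iff.1 hval
  refine ⟨min h₁ (h₂ / 2), lt_min hh₁ (by positivity), fun h hh hle hτh x' hx' => ?_⟩
  have hd := hsub₁ (show h ∈ Ioc 0 h₁ from ⟨hh, hle.trans (min_le_left _ _)⟩)
  have hh2 : h < h₂ := by linarith [hle.trans (min_le_right h₁ (h₂ / 2))]
  set Bad := Icc t₀ (t₀ + h) ∩ ⋃ i, (S.signSet i (σ i) (q₁ i) (q₂ i) N (q i))ᶜ with hBad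
  have hvolBad : volume Bad ≤ ENNReal.ofReal (ε * h) := by
    rw [hBad, inter_iUnion]
    refine (measure_iUnion_fintype_le _ _).trans ?_
    refine (Finset.sum_le_sum fun i _ => hd i).trans ?_
    rw [Finset.sum_const, Finset.card_univ, Fintype.card_fin, nsmul_eq_mul,
      ← ENNReal.ofReal_natCast, ← ENNReal.ofReal_mul (Nat.cast_nonneg _)]
    refine ENNReal.ofReal_le_ofReal ?_
    have : (p : ℝ) * (ε / (p + 1)) ≤ ε := by
      rw [mul_div_assoc', div_le_iff₀ (by positivity)]
      nlinarith
    nlinarith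
  -- The sign sets are only null measurable, so the exceptional set is enlarged to a measurable set
  -- of equal measure.
  refine H t₀ h (S.coeff y u) x' (fun i => bif σ i then 1 else -1) (toMeasurable volume Bad) hh hx'
    (hb.mono hτh) (measurableSet_toMeasurable _ _) ?_ (fun i => ?_) (fun i => ?_)
  · refine (measure_mono inter_subset_right).trans ?_
    rwa [measure_toMeasurable]
  · cases σ i <;> simp
  · have hle' : volume.restrict (Icc t₀ (t₀ + h)) ≤ volume.restrict (Icc t₀ τ) :=
      Measure.restrict_mono (Icc_subset_Icc_right hτh) le_rfl
    filter_upwards [ae_mono hle' hur, ae_mono hle' hyx, ae_restrict_mem measurableSet_Icc]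
      with s h1 h2 h3 h4
    have hsE : s ∈ S.signSet i (σ i) (q₁ i) (q₂ i) N (q i) := by
      by_contra hns
      exact h4 (subset_toMeasurable _ _ ⟨h3, mem_iUnion.2 ⟨i, hns⟩⟩)
    have hxs := hsub₂ (show s ∈ Metric.ball t₀ h₂ ∩ Icc t₀ τ from
      ⟨by rw [Metric.mem_ball, Real.dist_eq, abs_lt]; constructor <;> linarith [h3.1, h3.2],
        h3.1, h3.2.trans hτh⟩) i
    refine (hcq i).trans (hsE.2 (y s 0, u s) ⟨?_, ?_⟩)
    · rw [h2]; exact ⟨hxs.1.le, hxs.2.le⟩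
    · rw [mem_closedBall_zero_iff]; exact h1.trans hN

/-- Outputs at a density point are tame. -/
theorem Regular.exists_tame (hS : S.Regular) {I : Set ℝ} (hI : S.ObservabilityCondition I)
    (ht₀ : t₀ ∈ I) (hdens : S.IsDensityPoint t₀) (hτ : t₀ < τ) (hu : u ∈ allInputs m t₀ τ)
    (hy : y ∈ S.toControlSystem.outputs t₀ τ u) : ∃ M κ h₀, S.Tame t₀ τ M κ h₀ y u := by
  have ht₀' : 0 ≤ t₀ := hI.2.1 ht₀
  obtain ⟨hyLp, x₀, x, hx, hyx⟩ := hy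
  have hym : AEMeasurable y (volume.restrict (Icc t₀ τ)) := hyLp.1.aemeasurable
  have hum : AEMeasurable u (volume.restrict (Icc t₀ τ)) := hu.1.aemeasurable
  obtain ⟨r₁, hr₁⟩ := exists_ae_norm_le_of_memLp_top hyLp
  obtain ⟨r₂, hr₂⟩ := exists_ae_norm_le_of_memLp_top hu
  have hyr : ∀ᵐ t ∂(volume.restrict (Icc t₀ τ)), |y t 0| ≤ max r₁ r₂ := by
    filter_upwards [hr₁] with t ht
    exact (abs_apply_le_norm _ _).trans (ht.trans (le_max_left _ _))
  have hur : ∀ᵐ t ∂(volume.restrict (Icc t₀ τ)), ‖u t‖ ≤ max r₁ r₂ := by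
    filter_upwards [hr₂] with t ht using ht.trans (le_max_right _ _)
  obtain ⟨M, hM, hb⟩ := hS.exists_boundedCoeff ht₀' hym hum hyr hur
  have hx0 : x t₀ = x₀ := by simpa using hx.eq t₀ (left_mem_Icc.2 hτ.le)
  obtain ⟨κ, hκ, h₀, hh₀, hco⟩ := hS.exists_coercive ht₀' hτ hdens hur hM hb
    (x := fun t => x t 0)
    ((PiLp.continuous_apply 2 (fun _ => ℝ) 0).comp_continuousOn hx.continuousOn)
    (by filter_upwards [hyx] with t ht; rw [ht, C_act])
    (fun i u₀ => by rw [hx0]; exact hI.ne_zero ht₀ hτ hu hx i u₀)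
  exact ⟨M, κ, h₀, hτ, hM, hb, hκ, hh₀, hco,
    fun T hT d hd i => hS.intervalIntegrable_drift ht₀' hτ.le hym hum hyr hur hb hx hyx hT hd i,
    fun R => hS.drift_lipschitz ht₀' hyr hur R⟩

end Along

end TriangularSystem

/-! ### Essential suprema and dependence on almost everywhere classes -/

/-- Continuous functions that agree almost everywhere on a nondegenerate interval agree on it; this
is applied to `‖g‖` and `min ‖g‖ R`. -/
theorem norm_le_of_essNorm_le {n : ℕ} {g : ℝ → Vec n} {a b R : ℝ} (hab : a < b)
    (hg : ContinuousOn g (Icc a b)) (hR : 0 ≤ R) (h : essNorm (Icc a b) g ≤ ENNReal.ofReal R) :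
    ∀ t ∈ Icc a b, ‖g t‖ ≤ R := by
  have hae : (fun t => ‖g t‖) =ᵐ[volume.restrict (Icc a b)] fun t => min ‖g t‖ R := by
    rw [essNorm, eLpNorm_exponent_top] at h
    filter_upwards [ae_le_eLpNormEssSup (f := g) (μ := volume.restrict (Icc a b))] with t ht
    have h1 := ht.trans h
    rw [← ofReal_norm, ENNReal.ofReal_le_ofReal_iff hR] at h1
    rw [min_eq_left h1]
  have heq := Measure.eqOn_Icc_of_ae_eq volume hab.ne hae hg.norm
    (ContinuousOn.inf hg.norm continuousOn_const)
  intro t ht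
  have := heq ht
  simp only at this
  rw [this]
  exact min_le_right _ _

theorem essNorm_le_of_forall_norm_le {n : ℕ} {g : ℝ → Vec n} {s : Set ℝ} {R : ℝ}
    (hs : MeasurableSet s) (h : ∀ t ∈ s, ‖g t‖ ≤ R) : essNorm s g ≤ ENNReal.ofReal R := by
  rw [essNorm, eLpNorm_exponent_top]
  exact eLpNormEssSup_le_of_ae_bound ((ae_restrict_iff' hs).2 (Eventually.of_forall h))

theorem exists_strictAnti_le {δ : ℕ → ℝ} (hδ : ∀ ν, 0 < δ ν) :
    ∃ s : ℕ → ℝ, StrictAnti s ∧ ∀ ν, 0 < s ν ∧ s ν ≤ δ ν := by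
  let s : ℕ → ℝ := fun ν => Nat.rec (δ 0) (fun ν r => min (r / 2) (δ (ν + 1))) ν
  have hpos : ∀ ν, 0 < s ν := by
    intro ν
    induction ν with
    | zero => exact hδ 0
    | succ ν ih => exact lt_min (half_pos ih) (hδ _)
  refine ⟨s, strictAnti_nat_of_succ_lt fun ν => ?_, fun ν => ⟨hpos ν, ?_⟩⟩
  · exact (min_le_left _ _).trans_lt (half_lt_self (hpos ν))
  · cases ν with
    | zero => exact le_rfl
    | succ ν => exact min_le_right _ _

namespace ControlSystem

variable {n k m : ℕ} (S : ControlSystem n k m)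

section Congr

variable {S} {t₀ τ : ℝ} {y y' : ℝ → Vec k} {u u' : ℝ → Vec m}
  {Φ : ℝ → Matrix (Fin n) (Fin n) ℝ}

theorem integral_congr_of_ae_Icc {E : Type*} [NormedAddCommGroup E] [NormedSpace ℝ E]
    {f g : ℝ → E} {t : ℝ} (ht : t ∈ Icc t₀ τ) (h : f =ᵐ[volume.restrict (Icc t₀ τ)] g) :
    ∫ s in t₀..t, f s = ∫ s in t₀..t, g s := by
  refine intervalIntegral.integral_congr_ae ?_
  filter_upwards [(ae_restrict_iff' measurableSet_Icc).1 h] with s hs hs'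
  rw [uIoc_of_le ht.1] at hs'
  exact hs ⟨hs'.1.le, hs'.2.trans ht.2⟩

theorem Psi_congr (hu : u =ᵐ[volume.restrict (Icc t₀ τ)] u') {t : ℝ} (ht : t ∈ Icc t₀ τ) :
    S.Psi t₀ u Φ t = S.Psi t₀ u' Φ t := by
  ext i j
  refine integral_congr_of_ae_Icc ht ?_
  filter_upwards [hu] with s hs
  rw [hs]

theorem Xi_congr (hy : y =ᵐ[volume.restrict (Icc t₀ τ)] y')
    (hu : u =ᵐ[volume.restrict (Icc t₀ τ)] u') (d : ℝ → Vec n) {t : ℝ} (ht : t ∈ Icc t₀ τ) :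
    S.Xi t₀ y u Φ d t = S.Xi t₀ y' u' Φ d t := by
  refine integral_congr_of_ae_Icc ht ?_
  filter_upwards [hu, ae_restrict_mem measurableSet_Icc] with ρ hρ hρ'
  rw [hρ]
  congr 1
  refine integral_congr_of_ae_Icc hρ' ?_
  filter_upwards [hy, hu] with s h1 h2
  rw [h1, h2]

theorem iterOp_congr (hy : y =ᵐ[volume.restrict (Icc t₀ τ)] y')
    (hu : u =ᵐ[volume.restrict (Icc t₀ τ)] u') (d : ℝ → Vec n) {T t : ℝ} (hT : T ∈ Icc t₀ τ)
    (ht : t ∈ Icc t₀ T) : S.iterOp t₀ y u Φ T d t = S.iterOp t₀ y' u' Φ T d t := by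
  rw [iterOp, iterOp, Psi_congr hu hT, Xi_congr hy hu d hT]
  congr 1
  · congr 2
    refine integral_congr_of_ae_Icc hT ?_
    filter_upwards [hy, hu] with s h1 h2
    rw [h1, h2]
  · refine integral_congr_of_ae_Icc ⟨ht.1, ht.2.trans hT.2⟩ ?_
    filter_upwards [hy, hu] with s h1 h2
    rw [h1, h2]

theorem IsFundamental.congr (hτ : t₀ ≤ τ) (hy : y =ᵐ[volume.restrict (Icc t₀ τ)] y')
    (hu : u =ᵐ[volume.restrict (Icc t₀ τ)] u') (h : S.IsFundamental t₀ τ y u Φ) :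
    S.IsFundamental t₀ τ y' u' Φ := by
  have hae : ∀ i j, (fun s => (S.A s (y s) (u s) * Φ s) i j) =ᵐ[volume.restrict (Icc t₀ τ)]
      fun s => (S.A s (y' s) (u' s) * Φ s) i j := by
    intro i j
    filter_upwards [hy, hu] with s h1 h2
    rw [h1, h2]
  refine ⟨h.continuousOn, fun i j => (h.integrable i j).congr_ae ?_, fun t ht i j => ?_⟩
  · refine ae_mono (Measure.restrict_mono ?_ le_rfl) (hae i j)
    rw [uIoc_of_le hτ]
    exact Ioc_subset_Icc_self
  · rw [h.eq t ht i j, integral_congr_of_ae_Icc ht (hae i j)]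

/-- `y` and `u` enter a scheme only through integrals over subintervals of `[t₀,τ]`. -/
theorem IsScheme.congr {t : ℕ → ℕ → ℝ} {z : ℕ → ℕ → ℝ → Vec n}
    (hy : y =ᵐ[volume.restrict (Icc t₀ τ)] y') (hu : u =ᵐ[volume.restrict (Icc t₀ τ)] u')
    (h : S.IsScheme t₀ τ y u Φ t z) : S.IsScheme t₀ τ y' u' Φ t z := by
  have hmem : ∀ i ν, t i ν ∈ Icc t₀ τ := fun i ν => Ioc_subset_Icc_self (h.mem i ν)
  refine ⟨h.fundamental.congr ((h.mem 0 0).1.le.trans (h.mem 0 0).2) hy hu, h.mem, h.anti, h.lim,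
    h.diag, fun i ν d₁ d₂ h₁ h₂ h₃ h₄ => ?_, h.init, fun i ν s hs => ?_⟩
  · refine le_trans (le_of_eq ?_) (h.contraction i ν d₁ d₂ h₁ h₂ h₃ h₄)
    refine eLpNorm_congr_ae ?_
    filter_upwards [ae_restrict_mem measurableSet_Icc] with s hs
    rw [iterOp_congr hy hu d₁ (hmem i ν) hs, iterOp_congr hy hu d₂ (hmem i ν) hs]
  · rw [h.step i ν s hs, iterOp_congr hy hu _ (hmem i ν) hs]

end Congr

/-- A choice of an iteration scheme for `t₀, τ, y, u`, if there is one. -/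
noncomputable def chosenScheme (t₀ τ : ℝ) (y : ℝ → Vec k) (u : ℝ → Vec m) :
    (ℝ → Matrix (Fin n) (Fin n) ℝ) × (ℕ → ℕ → ℝ) × (ℕ → ℕ → ℝ → Vec n) :=
  Classical.epsilon fun q => S.IsScheme t₀ τ y u q.1 q.2.1 q.2.2

/-- The estimates computed by the chosen scheme. -/
noncomputable def estimate (ν : ℕ) (t₀ τ : ℝ) (y : ℝ → Vec k) (u : ℝ → Vec m) : Vec n :=
  (S.chosenScheme t₀ τ y u).2.2 ν ν ((S.chosenScheme t₀ τ y u).2.1 ν ν)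

theorem isScheme_chosenScheme {t₀ τ : ℝ} {y : ℝ → Vec k} {u : ℝ → Vec m}
    (h : ∃ Φ t z, S.IsScheme t₀ τ y u Φ t z) :
    S.IsScheme t₀ τ y u (S.chosenScheme t₀ τ y u).1 (S.chosenScheme t₀ τ y u).2.1
      (S.chosenScheme t₀ τ y u).2.2 := by
  obtain ⟨Φ, t, z, h⟩ := h
  exact Classical.epsilon_spec (p := fun q : (ℝ → Matrix (Fin n) (Fin n) ℝ) × (ℕ → ℕ → ℝ) ×
    (ℕ → ℕ → ℝ → Vec n) => S.IsScheme t₀ τ y u q.1 q.2.1 q.2.2) ⟨(Φ, t, z), h⟩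

theorem estimate_congr (ν : ℕ) {t₀ τ : ℝ} {y y' : ℝ → Vec k} {u u' : ℝ → Vec m}
    (hy : y =ᵐ[volume.restrict (Icc t₀ τ)] y') (hu : u =ᵐ[volume.restrict (Icc t₀ τ)] u') :
    S.estimate ν t₀ τ y u = S.estimate ν t₀ τ y' u' := by
  have : S.chosenScheme t₀ τ y u = S.chosenScheme t₀ τ y' u' := by
    unfold chosenScheme
    congr 1
    ext q
    exact ⟨fun h => h.congr hy hu, fun h => h.congr hy.symm hu.symm⟩
  rw [estimate, this, estimate]

end ControlSystem

/-! ### Existence and convergence of the iteration -/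

namespace TriangularSystem.Tame

variable {p m : ℕ} {S : TriangularSystem p m} {t₀ τ M κ h₀ : ℝ} {y : ℝ → Vec 1} {u : ℝ → Vec m}
  {Φ : ℝ → Matrix (Fin (p + 1)) (Fin (p + 1)) ℝ}

theorem exists_isFundamental (H : S.Tame t₀ τ M κ h₀ y u) :
    ∃ Φ, S.toControlSystem.IsFundamental t₀ τ y u Φ := by
  obtain ⟨Φ, hΦ⟩ := exists_fundamentalMatrix H.lt.le H.coeff
  exact ⟨Φ, S.isFundamental_of_fundamentalMatrix H.lt.le H.coeff hΦ⟩

theorem exists_contraction_time (H : S.Tame t₀ τ M κ h₀ y u)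
    (hΦ : FundamentalMatrix t₀ τ (S.coeff y u) Φ) {ℓ R : ℝ} (hℓ : 0 < ℓ) (hR : 0 < R) :
    ∃ η > 0, ∀ T, t₀ < T → T ≤ τ → T ≤ t₀ + η → ∀ d₁ d₂ : ℝ → Vec (p + 1),
      ContinuousOn d₁ (Icc t₀ T) → ContinuousOn d₂ (Icc t₀ T) →
      essNorm (Icc t₀ T) d₁ ≤ ENNReal.ofReal R → essNorm (Icc t₀ T) d₂ ≤ ENNReal.ofReal R →
      essNorm (Ioc t₀ T) (fun t => ((S.toControlSystem.Psi t₀ u Φ t)⁻¹).act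
        (S.toControlSystem.Xi t₀ y u Φ d₁ t - S.toControlSystem.Xi t₀ y u Φ d₂ t)) ≤
          ENNReal.ofReal ℓ * essNorm (Icc t₀ T) (fun t => d₁ t - d₂ t) ∧
      essNorm (Icc t₀ T) (fun s => S.toControlSystem.iterOp t₀ y u Φ T d₁ s -
        S.toControlSystem.iterOp t₀ y u Φ T d₂ s) ≤
          ENNReal.ofReal ℓ * essNorm (Icc t₀ T) (fun t => d₁ t - d₂ t) := by
  obtain ⟨K, hK, hcon⟩ := H.contraction hΦ R
  -- The first two bounds are the range of `Tame.contraction`; the third forces `K (T - t₀) ≤ ℓ`,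
  -- with `K + 1` because `K` may be zero.
  refine ⟨min h₀ (min 1 (ℓ / (K + 1))), lt_min H.h₀_pos (by positivity), ?_⟩
  intro T hT hTτ hTη d₁ d₂ hc₁ hc₂ he₁ he₂
  have hη1 : T ≤ t₀ + h₀ := hTη.trans (by gcongr; exact min_le_left _ _)
  have hη2 : T ≤ t₀ + 1 := hTη.trans (by
    gcongr; exact (min_le_right _ _).trans (min_le_left _ _))
  have hη3 : T - t₀ ≤ ℓ / (K + 1) := by
    have : min h₀ (min 1 (ℓ / (K + 1))) ≤ ℓ / (K + 1) :=
      (min_le_right _ _).trans (min_le_right _ _)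
    linarith
  have hKT : ∀ t ∈ Icc t₀ T, K * (t - t₀) ≤ ℓ := by
    intro t ht
    rw [le_div_iff₀ (by positivity)] at hη3
    nlinarith [ht.1, ht.2]
  have hR₁ := norm_le_of_essNorm_le hT hc₁ hR.le he₁
  have hR₂ := norm_le_of_essNorm_le hT hc₂ hR.le he₂
  have hfin : essNorm (Icc t₀ T) (fun t => d₁ t - d₂ t) ≠ ∞ :=
    ((essNorm_le_of_forall_norm_le (R := R + R) measurableSet_Icc fun t ht =>
      (norm_sub_le _ _).trans (add_le_add (hR₁ t ht) (hR₂ t ht))).trans_lt ENNReal.ofReal_lt_top).ne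
  set D := (essNorm (Icc t₀ T) (fun t => d₁ t - d₂ t)).toReal with hD
  have hD0 : 0 ≤ D := ENNReal.toReal_nonneg
  have hDeq : essNorm (Icc t₀ T) (fun t => d₁ t - d₂ t) = ENNReal.ofReal D :=
    (ENNReal.ofReal_toReal hfin).symm
  have hdD := norm_le_of_essNorm_le hT (hc₁.sub hc₂) hD0 hDeq.le
  rw [hDeq, ← ENNReal.ofReal_mul hℓ.le]
  -- The estimate for `Ψ⁻¹(t)` is wanted at every `t` up to `T`, so each `t` is taken as end time in
  -- turn.
  have hat : ∀ t ∈ Ioc t₀ T, _ := fun t (ht : t ∈ Ioc t₀ T) =>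
    hcon t ht.1 (ht.2.trans hTτ) (ht.2.trans hη1) (ht.2.trans hη2) d₁ d₂ D hD0
      (hc₁.mono (Icc_subset_Icc_right ht.2)) (hc₂.mono (Icc_subset_Icc_right ht.2))
      (fun s hs => hR₁ s (Icc_subset_Icc_right ht.2 hs))
      (fun s hs => hR₂ s (Icc_subset_Icc_right ht.2 hs))
      (fun s hs => hdD s (Icc_subset_Icc_right ht.2 hs))
  refine ⟨essNorm_le_of_forall_norm_le measurableSet_Ioc fun t ht => (hat t ht).1.trans ?_,
    essNorm_le_of_forall_norm_le measurableSet_Icc fun t ht =>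
      ((hat T (right_mem_Ioc.2 hT)).2 t ht).trans ?_⟩
  · exact mul_le_mul_of_nonneg_right (hKT t (Ioc_subset_Icc_self ht)) hD0
  · exact mul_le_mul_of_nonneg_right (hKT T (right_mem_Icc.2 hT.le)) hD0

theorem exists_isScheme (H : S.Tame t₀ τ M κ h₀ y u) :
    ∃ Φ t z, S.toControlSystem.IsScheme t₀ τ y u Φ t z := by
  obtain ⟨Φ, hΦ'⟩ := H.exists_isFundamental
  have hΦ := S.fundamentalMatrix_of_isFundamental H.lt.le hΦ'
  choose η hη hcon using fun i ν : ℕ => H.exists_contraction_time hΦ (ℓ := 1 / 2)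
    (R := ((i : ℝ) + 1) * 2 ^ ν) (by norm_num) (by positivity)
  -- The cap `1 / (ν + 1)` does not depend on `i`; this is what makes the diagonal times converge to
  -- `t₀`.
  choose s hs hs' using fun i : ℕ => exists_strictAnti_le
    (δ := fun ν => min (τ - t₀) (min (η i ν) (1 / ((ν : ℝ) + 1))))
    (fun ν => lt_min (sub_pos.2 H.lt) (lt_min (hη i ν) (by positivity)))
  have h1 : ∀ i ν, s i ν ≤ τ - t₀ := fun i ν => (hs' i ν).2.trans (min_le_left _ _)
  have h2 : ∀ i ν, s i ν ≤ η i ν := fun i ν =>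
    (hs' i ν).2.trans ((min_le_right _ _).trans (min_le_left _ _))
  have h3 : ∀ i ν : ℕ, s i ν ≤ 1 / ((ν : ℝ) + 1) := fun i ν =>
    (hs' i ν).2.trans ((min_le_right _ _).trans (min_le_right _ _))
  have hlim : ∀ c : ℕ → ℕ, Tendsto (fun ν => t₀ + s (c ν) ν) atTop (𝓝 t₀) := by
    intro c
    have h0 : Tendsto (fun ν => s (c ν) ν) atTop (𝓝 0) :=
      squeeze_zero (fun ν => (hs' (c ν) ν).1.le) (fun ν => h3 (c ν) ν)
        tendsto_one_div_add_atTop_nhds_zero_nat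
    simpa using h0.const_add t₀
  refine ⟨Φ, fun i ν => t₀ + s i ν, fun i ν => Nat.rec (fun _ => 0)
    (fun ν z => S.toControlSystem.iterOp t₀ y u Φ (t₀ + s i ν) z) ν, hΦ', fun i ν => ?_, fun i => ?_,
    fun i => hlim fun _ => i, hlim id, fun i ν d₁ d₂ hc₁ hc₂ he₁ he₂ => ?_, fun i s => rfl,
    fun i ν s _ => rfl⟩
  · exact ⟨by linarith [(hs' i ν).1], by linarith [h1 i ν]⟩
  · exact fun a b hab => by simpa using hs i hab
  · exact (hcon i ν (t₀ + s i ν) (by linarith [(hs' i ν).1]) (by linarith [h1 i ν])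
      (by linarith [h2 i ν]) d₁ d₂ hc₁ hc₂ he₁ he₂).2

/-- Every iteration scheme converges to every initial state producing the output. -/
theorem tendsto_of_isScheme (H : S.Tame t₀ τ M κ h₀ y u) {t : ℕ → ℕ → ℝ}
    {z : ℕ → ℕ → ℝ → Vec (p + 1)} (hsch : S.toControlSystem.IsScheme t₀ τ y u Φ t z)
    {x₀ : Vec (p + 1)} (hprod : S.toControlSystem.Produces t₀ τ u x₀ y) :
    Tendsto (fun ν => z ν ν (t ν ν)) atTop (𝓝 x₀) := by
  obtain ⟨x, hx, hyx⟩ := hprod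
  have hΦ := S.fundamentalMatrix_of_isFundamental H.lt.le hsch.fundamental
  have hx0 : x t₀ = x₀ := by simpa using hx.eq t₀ (left_mem_Icc.2 H.lt.le)
  obtain ⟨B, hB⟩ := isCompact_Icc.exists_bound_of_continuousOn hx.continuousOn
  have hB0 : 0 ≤ B := (norm_nonneg _).trans (hB t₀ (left_mem_Icc.2 H.lt.le))
  have hsub : ∀ i ν, Icc t₀ (t i ν) ⊆ Icc t₀ τ := fun i ν => Icc_subset_Icc_right (hsch.mem i ν).2
  have hlt : ∀ i ν, t₀ < t i ν := fun i ν => (hsch.mem i ν).1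
  -- The iterates stay within `B` of `x`, which is itself bounded by `B`. So `2 B ≤ i + 1` keeps
  -- both in the ball of contraction, and the fixed point property halves the error.
  have key : ∀ i : ℕ, 2 * B ≤ (i : ℝ) + 1 → ∀ ν, ContinuousOn (z i ν) (Icc t₀ (t i ν)) ∧
      ∀ s ∈ Icc t₀ (t i ν), ‖z i ν s - x s‖ ≤ B * (1 / 2) ^ ν := by
    intro i hi ν
    induction ν with
    | zero =>
      refine ⟨?_, fun s hs => ?_⟩
      · exact continuousOn_const.congr fun s _ => hsch.init i s
      · rw [hsch.init, zero_sub, norm_neg, pow_zero, mul_one]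
        exact hB s (hsub i 0 hs)
    | succ ν ih =>
      obtain ⟨hzc, hzx⟩ := ih
      have hxc : ContinuousOn x (Icc t₀ (t i ν)) := hx.continuousOn.mono (hsub i ν)
      have hTmem : t i ν ∈ Icc t₀ τ := Ioc_subset_Icc_self (hsch.mem i ν)
      have hci : ∀ {d}, ContinuousOn d (Icc t₀ (t i ν)) →
          ContinuousOn (S.toControlSystem.iterOp t₀ y u Φ (t i ν) d) (Icc t₀ (t i ν)) := fun hd =>
        S.continuousOn_iterOp (hΦ.mono hTmem.2) (hlt i ν).le (H.integrable _ hTmem _ hd)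
      have h1 : 2 * B ≤ ((i : ℝ) + 1) * 2 ^ ν :=
        hi.trans (le_mul_of_one_le_right (by positivity) (one_le_pow₀ (by norm_num)))
      have hpow : B * (1 / 2) ^ ν ≤ B :=
        mul_le_of_le_one_right hB0 (pow_le_one₀ (by norm_num) (by norm_num))
      have hz1 : essNorm (Icc t₀ (t i ν)) (z i ν) ≤ ENNReal.ofReal (((i : ℝ) + 1) * 2 ^ ν) := by
        refine essNorm_le_of_forall_norm_le measurableSet_Icc fun s hs => ?_
        have := norm_le_norm_sub_add (z i ν s) (x s)
        linarith [hzx s hs, hB s (hsub i ν hs)]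
      have hx1 : essNorm (Icc t₀ (t i ν)) x ≤ ENNReal.ofReal (((i : ℝ) + 1) * 2 ^ ν) :=
        essNorm_le_of_forall_norm_le measurableSet_Icc fun s hs => by
          linarith [hB s (hsub i ν hs)]
      have h2 := (hsch.contraction i ν _ _ hzc hxc hz1 hx1).trans
        (mul_le_mul_right (essNorm_le_of_forall_norm_le measurableSet_Icc hzx) _)
      rw [← ENNReal.ofReal_mul (by norm_num)] at h2
      have h3 := norm_le_of_essNorm_le (hlt i ν) ((hci hzc).sub (hci hxc)) (by positivity) h2
      have hsub' : Icc t₀ (t i (ν + 1)) ⊆ Icc t₀ (t i ν) :=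
        Icc_subset_Icc_right (hsch.anti i (Nat.lt_succ_self ν)).le
      refine ⟨((hci hzc).congr fun s hs => hsch.step i ν s hs).mono hsub', fun s hs => ?_⟩
      rw [hsch.step i ν s (hsub' hs)]
      have h4 := h3 s (hsub' hs)
      rw [Pi.sub_apply, H.iterOp_eq_self hΦ hx hyx (hsch.mem i ν) (hsub' hs)] at h4
      rw [pow_succ]
      linarith
  have hdiff : Tendsto (fun ν => z ν ν (t ν ν) - x (t ν ν)) atTop (𝓝 0) := by
    have hb : Tendsto (fun ν : ℕ => B * (1 / 2 : ℝ) ^ ν) atTop (𝓝 0) := by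
      simpa using (tendsto_pow_atTop_nhds_zero_of_lt_one (r := (1 / 2 : ℝ)) (by norm_num)
        (by norm_num)).const_mul B
    refine squeeze_zero_norm' ?_ hb
    -- On the diagonal the guess grows with `ν`, so from `i₀` on it is valid, although `B` is
    -- unknown to the scheme.
    obtain ⟨i₀, hi₀⟩ := exists_nat_ge (2 * B)
    filter_upwards [eventually_ge_atTop i₀] with ν hν
    have : (i₀ : ℝ) ≤ ν := by exact_mod_cast hν
    exact (key ν (by linarith) ν).2 _ (right_mem_Icc.2 (hlt ν ν).le)
  have hxt : Tendsto (fun ν => x (t ν ν)) atTop (𝓝 x₀) := by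
    rw [← hx0]
    refine (hx.continuousOn t₀ (left_mem_Icc.2 H.lt.le)).tendsto.comp ?_
    exact tendsto_nhdsWithin_iff.2 ⟨hsch.diag,
      Eventually.of_forall fun ν => Ioc_subset_Icc_self (hsch.mem ν ν)⟩
  simpa using hdiff.add hxt

end TriangularSystem.Tame

/-! ### Assembly -/

theorem closure_inter_ae_eq {I : Set ℝ} {P : ℝ → Prop} (hP : ∀ᵐ t : ℝ, P t)
    (hpos : ∀ t ∈ I, ∀ ε > (0 : ℝ), 0 < volume (I ∩ Ioo (t - ε) (t + ε))) :
    closure (I ∩ {t | P t}) = closure I := by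
  refine (closure_mono inter_subset_left).antisymm (closure_minimal (fun t ht => ?_) isClosed_closure)
  refine Metric.mem_closure_iff.2 fun ε hε => ?_
  have h1 : volume ((I ∩ Ioo (t - ε) (t + ε)) ∩ {t | P t}) ≠ 0 := by
    rw [measure_inter_conull (mem_ae_iff.1 hP)]
    exact (hpos t ht ε hε).ne'
  obtain ⟨s, ⟨hsI, hs⟩, hsP⟩ := nonempty_of_measure_ne_zero h1
  refine ⟨s, ⟨hsI, hsP⟩, ?_⟩
  rw [Real.dist_eq, abs_lt]
  constructor <;> linarith [hs.1, hs.2]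

theorem proposition3p1 {p m : ℕ} (S : TriangularSystem p m) (hS : S.Regular)
    (I : Set ℝ) (hI : S.ObservabilityCondition I)
    (hpos : ∀ t ∈ I, ∀ ε > (0 : ℝ), 0 < volume (I ∩ Ioo (t - ε) (t + ε))) :
    ∃ J : Set ℝ, J ⊆ I ∧ closure J = closure I ∧
      S.toControlSystem.A1 (allInputs m) J ∧
      S.toControlSystem.A2 (allInputs m) J ∧
      S.toControlSystem.ApproxSEDPSolvable (allInputs m) J ∧
      S.toControlSystem.Observable (allInputs m) J := by
  set J := I ∩ {t | S.IsDensityPoint t} with hJ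
  have hcl : closure J = closure I := closure_inter_ae_eq hS.ae_isDensityPoint hpos
  -- The length `1` is arbitrary: tameness holds for every end time after `t₀`.
  have tame : ∀ t₀ ∈ J, ∀ τ ∈ Ioo t₀ (t₀ + 1), ∀ u ∈ allInputs m t₀ τ,
      ∀ y ∈ S.toControlSystem.outputs t₀ τ u, ∃ M κ h₀, S.Tame t₀ τ M κ h₀ y u :=
    fun t₀ ht₀ τ hτ u hu y hy => hS.exists_tame hI ht₀.1 ht₀.2 hτ.1 hu hy
  have est : S.toControlSystem.Estimates (allInputs m) J S.toControlSystem.estimate := by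
    refine ⟨fun ν t₀ τ y y' u u' hy hu => S.toControlSystem.estimate_congr ν hy hu,
      fun t₀ ht₀ => ⟨1, one_pos, fun τ hτ u hu y hy => ?_⟩⟩
    obtain ⟨M, κ, h₀, H⟩ := tame t₀ ht₀ τ hτ u hu y hy
    have hsch := S.toControlSystem.isScheme_chosenScheme H.exists_isScheme
    obtain ⟨-, x₀, hx₀⟩ := hy
    -- Any other initial state producing `y` is a limit of the same estimates, hence equal to `x₀`.
    exact ⟨x₀, H.tendsto_of_isScheme hsch hx₀, hx₀, fun x₁ hx₁ =>
      tendsto_nhds_unique (H.tendsto_of_isScheme hsch hx₁) (H.tendsto_of_isScheme hsch hx₀)⟩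
  refine ⟨J, inter_subset_left, hcl, ⟨?_, fun t ht => hI.2.1 ht.1, fun t₀ ht₀ => ⟨1, one_pos,
    fun τ hτ u hu y hy => ?_⟩⟩, fun t₀ ht₀ => ⟨1, one_pos, fun T hT u hu y hy => ?_⟩,
    ⟨S.toControlSystem.estimate, est, fun t₀ ht₀ => ⟨1, one_pos, fun τ hτ u hu y hy => ?_⟩⟩,
    fun t₀ ht₀ => ?_⟩
  · rw [← closure_nonempty_iff, hcl, closure_nonempty_iff]
    exact hI.2.2.1.mono interior_subset
  · obtain ⟨M, κ, h₀, H⟩ := tame t₀ ht₀ τ hτ u hu y hy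
    obtain ⟨Φ, hΦ⟩ := H.exists_isFundamental
    refine ⟨Φ, hΦ, fun t ht => ?_⟩
    rw [TriangularSystem.Psi_eq_gram]
    exact H.gram_posDef (S.fundamentalMatrix_of_isFundamental H.lt.le hΦ) ht
  · obtain ⟨M, κ, h₀, H⟩ := tame t₀ ht₀ T hT u hu y hy
    obtain ⟨Φ, hΦ⟩ := H.exists_isFundamental
    refine ⟨Φ, hΦ, fun ℓ hℓ R hR θ hθ => ?_⟩
    obtain ⟨η, hη, hcon⟩ := H.exists_contraction_time
      (S.fundamentalMatrix_of_isFundamental H.lt.le hΦ) hℓ.1 hR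
    obtain ⟨τ, hτ₁, hτ₂⟩ := exists_between
      (show t₀ < min (min (t₀ + θ) T) (t₀ + η) from
        lt_min (lt_min (by linarith) H.lt) (by linarith))
    have hτ₃ := hτ₂.trans_le (min_le_left _ _)
    exact ⟨τ, ⟨hτ₁, hτ₃⟩, fun d₁ d₂ hc₁ hc₂ he₁ he₂ =>
      (hcon τ hτ₁ (hτ₃.trans_le (min_le_right _ _)).le (hτ₂.trans_le (min_le_right _ _)).le
        d₁ d₂ hc₁ hc₂ he₁ he₂).1⟩
  · obtain ⟨M, κ, h₀, H⟩ := tame t₀ ht₀ τ hτ u hu y hy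
    exact ⟨_, _, _, S.toControlSystem.isScheme_chosenScheme H.exists_isScheme, fun ν => rfl⟩
  · obtain ⟨δ, hδ, h⟩ := est.2 t₀ ht₀
    refine ⟨δ, hδ, ae_restrict_of_forall_mem measurableSet_Ioo fun τ hτ u hu y hy => ?_⟩
    obtain ⟨x₀, -, hx₀, huniq⟩ := h τ hτ u hu y hy
    exact ⟨x₀, hx₀, huniq⟩
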